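/- Let $N\ge 2$, $n\ge 1$ and let $\mathcal G$ be a directed graph on $\{1,\dots,N\}$, where an edge $(j,i)$ means that agent $i$ obtains information from agent $j$; put $\mathcal N_i=\{j : (j,i)\text{ is an edge}\}$. Assume that $\mathcal G$ has a directed spanning tree (some vertex has directed paths to all others). Let $\mathcal L=\mathcal D-\mathcal A$ be its Laplacian ($a_{ij}=1$ if $j\in\mathcal N_i$, $a_{ij}=0$ otherwise, $d_{ii}=\sum_{j\in\mathcal N_i}a_{ij}$), and let $\lambda_2$ be a nonzero eigenvalue of $\mathcal L$ with smallest real part among the nonzero eigenvalues. Let $A\in\mathbb R^{n\times n}$, $B\in\mathbb R^{n\times m}$ with $(A,B)$ controllable, let $\alpha>0$, let $P$ be a symmetric positive definite solution of $PA+A^TP-2PBB^TP+2\alpha P<0$, and set $F=-B^TP$ and $c\ge 1/\mathrm{Re}(\lambda_2)$. Let $S_L\in\mathbb C^{N\times N}$ be invertible with $S_L^{-1}\mathcal L S_L=\mathrm{diag}(0,J)$, $J\in\mathbb C^{(N-1)\times(N-1)}$ in Jordan canonical form, and put $$\hat A=I_{N-1}\otimes A+cJ\otimes BF,\quad \hat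 B=c\Delta\otimes BF,\quad \Delta=[\,0\ \ J\,]S_L^{-1},\quad \Theta=S_L\begin{bmatrix}0\\ J\end{bmatrix}.$$ All norms are Euclidean, respectively spectral, norms. Then $\hat A$ is Hurwitz, so that there are $\hat\beta,\hat\lambda>0$ with $\|e^{\hat At}\|\le\hat\beta e^{-\hat\lambda t}$ for all $t\ge 0$. For any such $\hat\beta,\hat\lambda$, any $0<\lambda<\hat\lambda$ and any $\beta>0$, consider the closed loop $$\dot x_i=Ax_i+Bu_i,\qquad u_i=cF\sum_{j\in\mathcal N_i}(y_i-y_j),\qquad i=1,\dots,N,$$ where each $x_i$ is continuous; agent $i$ has an event at time $t_{0_i}=0$, and an event at a time $t>0$ exactly when $\|e_i(t^-)\|=\beta e^{-\lambda t}$, $e_i=y_i-x_i$; and between its consecutive event times $t_{k_i}$ the model state satisfies $\dot y_i=Ay_i$ on $[t_{k_i},t_{k_i+1})$, $y_i(t_{k_i})=x_i(t_{k_i})$. A solution is considered on a horizon $[0,T)$, $0<T\le\infty$, in which event times do not accumulate, and $T<\infty$ only if the event times of some agent accumulate at $T$. Then, for every solution: (i) there is no Zeno behavior: every agent has finitely many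 events in each bounded time interval, and $T=\infty$; (ii) the agents achieve consensus asymptotically: $\|x_i(t)-x_j(t)\|\to 0$ as $t\to\infty$ for all $i,j$; (iii) for every agent $i$ and every pair of consecutive event times $t_{k_i}<t_{k_i+1}$, $$t_{k_i+1}-t_{k_i}\ \ge\ \tau=\frac{\ln(1+\beta/K_3)}{\|A\|+\hat\lambda}>0,\qquad K_3=\|cBF\|\Big(\frac{K_1e^{(\lambda-\hat\lambda)t_{k_i}}}{\|A\|+\hat\lambda}+\frac{K_2}{\|A\|+\lambda}\Big)>0,$$ $$K_1=\|\Theta\|\Big(\hat\beta\hat x_0-\frac{\sqrt N\beta\hat\beta\|\hat B\|}{\hat\lambda-\lambda}\Big),\qquad K_2=\|\Theta\|\frac{\sqrt N\beta\hat\beta\|\hat B\|}{\hat\lambda-\lambda}+\|\mathcal L\|\sqrt N\beta,$$ where $\hat x_0$ is the norm of $(S_L\otimes I_n)^{-1}x(0)$ with its first block of $n$ entries removed and $x(0)=(x_1(0)^T,\dots,x_N(0)^T)^T$. The values $\tau=\tau(t_{k_i})$ and $K_3=K_3(t_{k_i})$ are positive at every event time $t_{k_i}$, and the values $\tau(t_{k_i})$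 are bounded below by a positive constant that depends neither on the agent nor on the event. -/

import Mathlib

open Filter Topology
open scoped Matrix Kronecker Matrix.Norms.L2Operator

/-!
The norm of a real or complex matrix is the spectral norm (the operator norm for Euclidean
norms), made available by `Matrix.Norms.L2Operator`. The number of agents is `M + 1`.
-/

noncomputable section

namespace EventConsensus

/-- Entrywise inclusion of real matrices into complex matrices. -/
def toC {p q : Type*} (X : Matrix p q ℝ) : Matrix p q ℂ := X.map (fun r : ℝ => (r : ℂ))

section Graph

variable {N : ℕ}

/-- A directed graph has a directed spanning tree: some agent has directed paths to all other
agents. -/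
def HasSpanningTree (G : Digraph (Fin N)) : Prop :=
  ∃ r, ∀ v, Relation.ReflTransGen G.Adj r v

open Classical in
/-- The neighbors of agent `i`: the agents `j` with an edge `(j, i)`, that is, the agents from
which `i` obtains information. -/
def neighbors (G : Digraph (Fin N)) (i : Fin N) : Finset (Fin N) :=
  Finset.univ.filter (fun j => G.Adj j i)

open Classical in
/-- The adjacency matrix: `a i j = 1` if `(j, i)` is an edge, and `0` otherwise. -/
def adjacency (G : Digraph (Fin N)) : Matrix (Fin N) (Fin N) ℝ :=
  Matrix.of fun i j => if G.Adj j i then 1 else 0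

/-- The Laplacian `𝓛 = 𝓓 - 𝓐`, with `d i i = ∑ j ∈ 𝓝 i, a i j`. -/
def laplacian (G : Digraph (Fin N)) : Matrix (Fin N) (Fin N) ℝ :=
  Matrix.diagonal (fun i => ∑ j ∈ neighbors G i, adjacency G i j) - adjacency G

/-- `μ` is the eigenvalue `λ₂(𝓛)`: a nonzero eigenvalue of the Laplacian, of smallest real part
among the nonzero eigenvalues. -/
def IsLambdaTwo (G : Digraph (Fin N)) (μ : ℂ) : Prop :=
  Module.End.HasEigenvalue (Matrix.toLin' (toC (laplacian G))) μ ∧ μ ≠ 0 ∧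
    ∀ ν : ℂ, Module.End.HasEigenvalue (Matrix.toLin' (toC (laplacian G))) ν → ν ≠ 0 →
      μ.re ≤ ν.re

end Graph

section Design

variable {n m : ℕ}

/-- The controllability matrix `[B, AB, …, Aⁿ⁻¹B]`. -/
def controllabilityMatrix (A : Matrix (Fin n) (Fin n) ℝ) (B : Matrix (Fin n) (Fin m) ℝ) :
    Matrix (Fin n) (Fin n × Fin m) ℝ :=
  Matrix.of fun i p => (A ^ (p.1 : ℕ) * B) i p.2

/-- The pair `(A, B)` is controllable. -/
def Controllable (A : Matrix (Fin n) (Fin n) ℝ) (B : Matrix (Fin n) (Fin m) ℝ) : Prop :=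
  (controllabilityMatrix A B).rank = n

/-- `P` is a symmetric positive definite solution of the linear matrix inequality
`P A + Aᵀ P - 2 P B Bᵀ P + 2 α P < 0`. -/
def SolvesLMI (A : Matrix (Fin n) (Fin n) ℝ) (B : Matrix (Fin n) (Fin m) ℝ) (α : ℝ)
    (P : Matrix (Fin n) (Fin n) ℝ) : Prop :=
  P.PosDef ∧
    (-(P * A + Aᵀ * P - (2 : ℝ) • (P * B * Bᵀ * P) + (2 * α) • P)).PosDef

/-- The gain `F = -Bᵀ P`. -/
def gain (B : Matrix (Fin n) (Fin m) ℝ) (P : Matrix (Fin n) (Fin n) ℝ) :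
    Matrix (Fin m) (Fin n) ℝ :=
  -(Bᵀ * P)

end Design

section Transform

variable {M : ℕ}

/-- The square matrix `J` is in Jordan canonical form (a block diagonal matrix of Jordan blocks,
with ones on the superdiagonal of each block). -/
def IsJordanForm (J : Matrix (Fin M) (Fin M) ℂ) : Prop :=
  ∀ i j, J i j ≠ 0 → j = i ∨ ((j : ℕ) = (i : ℕ) + 1 ∧ J i j = 1 ∧ J i i = J j j)

/-- The matrix `[0 J]`, with a zero column in front of `J`. -/
def zeroCol (J : Matrix (Fin M) (Fin M) ℂ) : Matrix (Fin M) (Fin (M + 1)) ℂ :=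
  Matrix.of fun i => Fin.cons 0 (J i)

/-- The matrix `[0; J]`, with a zero row on top of `J`. -/
def zeroRow (J : Matrix (Fin M) (Fin M) ℂ) : Matrix (Fin (M + 1)) (Fin M) ℂ :=
  Matrix.of (Fin.cons 0 J)

/-- The block diagonal matrix `diag(0, J)`, with a scalar zero block. -/
def zeroBlock (J : Matrix (Fin M) (Fin M) ℂ) : Matrix (Fin (M + 1)) (Fin (M + 1)) ℂ :=
  Matrix.of (Fin.cons 0 (zeroCol J))

/-- `S` is a similarity transformation with `S⁻¹ 𝓛 S = diag(0, J)`, where `J` is in Jordan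
canonical form. -/
def IsJordanTransform (G : Digraph (Fin (M + 1))) (SL : Matrix (Fin (M + 1)) (Fin (M + 1)) ℂ)
    (J : Matrix (Fin M) (Fin M) ℂ) : Prop :=
  IsUnit SL.det ∧ IsJordanForm J ∧ SL⁻¹ * toC (laplacian G) * SL = zeroBlock J

variable {n m : ℕ}

/-- `Â = I ⊗ A + c J ⊗ B F`. -/
def Ahat (A : Matrix (Fin n) (Fin n) ℝ) (B : Matrix (Fin n) (Fin m) ℝ)
    (F : Matrix (Fin m) (Fin n) ℝ) (c : ℝ) (J : Matrix (Fin M) (Fin M) ℂ) :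
    Matrix (Fin M × Fin n) (Fin M × Fin n) ℂ :=
  (1 : Matrix (Fin M) (Fin M) ℂ) ⊗ₖ toC A + ((c : ℂ) • J) ⊗ₖ toC (B * F)

/-- `‖exp(Â t)‖ ≤ β̂ exp(-λ̂ t)` for all `t ≥ 0`. -/
def ExpBound {q : Type*} [Fintype q] [DecidableEq q] (X : Matrix q q ℂ) (bh lh : ℝ) : Prop :=
  ∀ t : ℝ, 0 ≤ t → ‖NormedSpace.exp ((t : ℂ) • X)‖ ≤ bh * Real.exp (-lh * t)

/-- `Δ = [0 J] S⁻¹`. -/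
def Delta (SL : Matrix (Fin (M + 1)) (Fin (M + 1)) ℂ) (J : Matrix (Fin M) (Fin M) ℂ) :
    Matrix (Fin M) (Fin (M + 1)) ℂ :=
  zeroCol J * SL⁻¹

/-- `B̂ = c Δ ⊗ B F`. -/
def Bhat (B : Matrix (Fin n) (Fin m) ℝ) (F : Matrix (Fin m) (Fin n) ℝ) (c : ℝ)
    (SL : Matrix (Fin (M + 1)) (Fin (M + 1)) ℂ) (J : Matrix (Fin M) (Fin M) ℂ) :
    Matrix (Fin M × Fin n) (Fin (M + 1) × Fin n) ℂ :=
  ((c : ℂ) • Delta SL J) ⊗ₖ toC (B * F)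

/-- `Θ = S [0; J]`. -/
def Theta (SL : Matrix (Fin (M + 1)) (Fin (M + 1)) ℂ) (J : Matrix (Fin M) (Fin M) ℂ) :
    Matrix (Fin (M + 1)) (Fin M) ℂ :=
  SL * zeroRow J

/-- The vector `x̂ = (S ⊗ I)⁻¹ x` without its first block, where `x` is the stacked vector of the
states of the agents. -/
def xhatTail (SL : Matrix (Fin (M + 1)) (Fin (M + 1)) ℂ)
    (x : Fin (M + 1) → EuclideanSpace ℝ (Fin n)) : EuclideanSpace ℂ (Fin M × Fin n) :=
  WithLp.toLp 2 fun p : Fin M × Fin n =>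
    ((SL ⊗ₖ (1 : Matrix (Fin n) (Fin n) ℂ))⁻¹ *ᵥ
      fun q : Fin (M + 1) × Fin n => ((x q.1 q.2 : ℝ) : ℂ)) (p.1.succ, p.2)

end Transform

section Bounds

variable {M n m : ℕ}

/-- `K₁ = ‖Θ‖ (β̂ ‖x̂₂.. (0)‖ - √N β β̂ ‖B̂‖ / (λ̂ - λ))`. -/
def K1 (B : Matrix (Fin n) (Fin m) ℝ) (F : Matrix (Fin m) (Fin n) ℝ) (c : ℝ)
    (SL : Matrix (Fin (M + 1)) (Fin (M + 1)) ℂ) (J : Matrix (Fin M) (Fin M) ℂ)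
    (bh lh β lam : ℝ) (x0 : Fin (M + 1) → EuclideanSpace ℝ (Fin n)) : ℝ :=
  ‖Theta SL J‖ * (bh * ‖xhatTail SL x0‖ -
    √((M + 1 : ℕ) : ℝ) * β * bh * ‖Bhat B F c SL J‖ / (lh - lam))

/-- `K₂ = ‖Θ‖ √N β β̂ ‖B̂‖ / (λ̂ - λ) + ‖𝓛‖ √N β`. -/
def K2 (G : Digraph (Fin (M + 1))) (B : Matrix (Fin n) (Fin m) ℝ)
    (F : Matrix (Fin m) (Fin n) ℝ) (c : ℝ)
    (SL : Matrix (Fin (M + 1)) (Fin (M + 1)) ℂ) (J : Matrix (Fin M) (Fin M) ℂ)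
    (bh lh β lam : ℝ) : ℝ :=
  ‖Theta SL J‖ * (√((M + 1 : ℕ) : ℝ) * β * bh * ‖Bhat B F c SL J‖ / (lh - lam)) +
    ‖laplacian G‖ * √((M + 1 : ℕ) : ℝ) * β

/-- `K₃ = ‖c B F‖ (K₁ exp((λ - λ̂) s) / (‖A‖ + λ̂) + K₂ / (‖A‖ + λ))`, at the event time `s`. -/
def K3 (G : Digraph (Fin (M + 1))) (A : Matrix (Fin n) (Fin n) ℝ)
    (B : Matrix (Fin n) (Fin m) ℝ) (F : Matrix (Fin m) (Fin n) ℝ) (c : ℝ)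
    (SL : Matrix (Fin (M + 1)) (Fin (M + 1)) ℂ) (J : Matrix (Fin M) (Fin M) ℂ)
    (bh lh β lam : ℝ) (x0 : Fin (M + 1) → EuclideanSpace ℝ (Fin n)) (s : ℝ) : ℝ :=
  ‖c • (B * F)‖ *
    (K1 B F c SL J bh lh β lam x0 * Real.exp ((lam - lh) * s) / (‖A‖ + lh) +
      K2 G B F c SL J bh lh β lam / (‖A‖ + lam))

/-- `τ = ln(1 + β / K₃) / (‖A‖ + λ̂)`, at the event time `s`. -/
def tau (G : Digraph (Fin (M + 1))) (A : Matrix (Fin n) (Fin n) ℝ)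
    (B : Matrix (Fin n) (Fin m) ℝ) (F : Matrix (Fin m) (Fin n) ℝ) (c : ℝ)
    (SL : Matrix (Fin (M + 1)) (Fin (M + 1)) ℂ) (J : Matrix (Fin M) (Fin M) ℂ)
    (bh lh β lam : ℝ) (x0 : Fin (M + 1) → EuclideanSpace ℝ (Fin n)) (s : ℝ) : ℝ :=
  Real.log (1 + β / K3 G A B F c SL J bh lh β lam x0 s) / (‖A‖ + lh)

end Bounds

section ClosedLoop

variable {N n m : ℕ}

/-- The input `u i = c F ∑ j ∈ 𝓝 i, (y i - y j)`, for given model states `y`. -/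
def input (G : Digraph (Fin N)) (c : ℝ) (F : Matrix (Fin m) (Fin n) ℝ)
    (y : Fin N → EuclideanSpace ℝ (Fin n)) (i : Fin N) : EuclideanSpace ℝ (Fin m) :=
  c • Matrix.toEuclideanLin F (∑ j ∈ neighbors G i, (y i - y j))

/-- A closed-loop trajectory on the horizon `[0, T)`, `0 < T ≤ ∞`, with agent states `x`, model
states `y` and sets of event times `E`. Events of an agent may accumulate at a finite `T` (this is
what Zeno behavior means), and a trajectory stops at a finite `T` for no other reason. -/
structure IsTrajectory (G : Digraph (Fin N)) (A : Matrix (Fin n) (Fin n) ℝ)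
    (B : Matrix (Fin n) (Fin m) ℝ) (F : Matrix (Fin m) (Fin n) ℝ) (c β lam : ℝ) (T : EReal)
    (x y : Fin N → ℝ → EuclideanSpace ℝ (Fin n)) (E : Fin N → Set ℝ) : Prop where
  pos : 0 < T
  /-- Event times lie in the horizon, and every agent transmits at time `0`. -/
  events_mem : ∀ i, ∀ s ∈ E i, 0 ≤ s ∧ (s : EReal) < T
  zero_mem : ∀ i, (0 : ℝ) ∈ E i
  /-- Event times do not accumulate before the end of the horizon. -/
  locally_finite : ∀ i, ∀ s : ℝ, (s : EReal) < T → (E i ∩ Set.Iic s).Finite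
  /-- The horizon is finite only if the events of some agent accumulate at its end. -/
  maximal : T ≠ ⊤ → ∃ i, (E i).Infinite
  /-- Agent dynamics: `x i` is continuous and `x i' = A (x i) + B (u i)`, as a right derivative
  at every time (the input may jump at event times). -/
  x_cont : ∀ i, ContinuousOn (x i) {s : ℝ | 0 ≤ s ∧ (s : EReal) < T}
  x_deriv : ∀ i, ∀ s : ℝ, 0 ≤ s → (s : EReal) < T →
    HasDerivWithinAt (x i)
      (Matrix.toEuclideanLin A (x i s) +
        Matrix.toEuclideanLin B (input G c F (fun j => y j s) i)) (Set.Ici s) s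
  /-- Model update: at an event time the model state is reset to the agent state. -/
  y_reset : ∀ i, ∀ s ∈ E i, y i s = x i s
  /-- Model dynamics `y i' = A (y i)`: from the right at event times, two-sided in between. -/
  y_deriv_event : ∀ i, ∀ s ∈ E i,
    HasDerivWithinAt (y i) (Matrix.toEuclideanLin A (y i s)) (Set.Ici s) s
  y_deriv : ∀ i, ∀ s : ℝ, 0 < s → (s : EReal) < T → s ∉ E i →
    HasDerivAt (y i) (Matrix.toEuclideanLin A (y i s)) s
  /-- Triggering rule: after time `0`, agent `i` has an event at `s` exactly when the norm of its
  error `y i - x i` (just before a possible reset) reaches the threshold `β exp(-λ s)`. -/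
  trigger : ∀ i, ∀ s : ℝ, 0 < s → (s : EReal) < T →
    (s ∈ E i ↔
      Tendsto (fun r => ‖y i r - x i r‖) (𝓝[<] s) (𝓝 (β * Real.exp (-lam * s))))

/-- Zeno behavior: some agent has infinitely many events in a bounded time interval. -/
def IsZeno (E : Fin N → Set ℝ) : Prop :=
  ∃ i, ∃ s : ℝ, (E i ∩ Set.Icc 0 s).Infinite

/-- Asymptotic consensus: the differences of the agent states tend to zero. -/
def Consensus (x : Fin N → ℝ → EuclideanSpace ℝ (Fin n)) : Prop :=
  ∀ i j, Tendsto (fun t => ‖x i t - x j t‖) atTop (𝓝 0)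

end ClosedLoop

end EventConsensus

end

/-! With a spanning tree, the kernel of the Laplacian is the line of constant vectors. In the
coordinates given by `SL⁻¹`, dropping the first block therefore removes exactly the consensus
direction. The remaining vector x̂ satisfies x̂' = Â x̂ + B̂ e, where e is the stacked model error,
and differences of agent states are linear in x̂.

Stability of Â: Gershgorin's theorem gives Re λ₂ > 0, and simplicity of the eigenvalue 0 makes every
diagonal entry of `J` a nonzero eigenvalue, so c Re J_kk ≥ 1. The matrix inequality then makes I ⊗ P
a Lyapunov matrix for the block diagonal part of Â. A diagonal similarity makes the superdiagonal of
`J` so small that the estimate survives (`exists_expBound_Ahat`).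

Consensus: the triggering rule and the intermediate value theorem keep each error below β exp(-λt)
(`norm_error_lt`). Variation of constants (`norm_le_of_exp_decay`) then bounds x̂ by exponentials
decaying at rates λ̂ and λ.

Inter-event times: the same bound shows that the coupling term seen by an agent is at most K₁
exp(-λ̂t) + K₂ exp(-λt). After an event the error starts from 0 and obeys a linear equation driven
by this term, so it stays below the explicit scalar solution `errorProfile`. The next event requires
this profile to reach the threshold, which takes at least the time τ
(`log_div_le_of_threshold_le_errorProfile`). Since τ is uniformly positive, events cannot
accumulate, and the horizon is infinite. -/

namespace EventConsensus

/-! ### Linear differential equations: variation of constants and comparison. -/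

section LinearODE

variable {q : Type*} [Fintype q] [DecidableEq q]

theorem norm_toEuclideanLin_le {𝕜 p : Type*} [RCLike 𝕜] [Fintype p] (X : Matrix p q 𝕜)
    (v : EuclideanSpace 𝕜 q) : ‖Matrix.toEuclideanLin X v‖ ≤ ‖X‖ * ‖v‖ :=
  Matrix.l2_opNorm_mulVec X v

theorem toEuclideanLin_mul {𝕜 p r : Type*} [RCLike 𝕜] [Fintype r] [DecidableEq r]
    (X : Matrix p q 𝕜) (Y : Matrix q r 𝕜) (v : EuclideanSpace 𝕜 r) :
    Matrix.toEuclideanLin (X * Y) v = Matrix.toEuclideanLin X (Matrix.toEuclideanLin Y v) := by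
  simp [Matrix.toLpLin_apply, Matrix.mulVec_mulVec]

theorem hasDerivAt_toEuclideanLin_exp (X : Matrix q q ℂ) (v : EuclideanSpace ℂ q) (t : ℝ) :
    HasDerivAt (fun s : ℝ => Matrix.toEuclideanLin (NormedSpace.exp ((s : ℂ) • X)) v)
      (Matrix.toEuclideanLin (NormedSpace.exp ((t : ℂ) • X) * X) v) t := by
  let ℓ : Matrix q q ℂ →ₗ[ℂ] EuclideanSpace ℂ q :=
    { toFun := fun Y => Matrix.toEuclideanLin Y v
      map_add' := fun Y Z => by simp
      map_smul' := fun k Y => by simp }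
  have h := (LinearMap.toContinuousLinearMap ℓ).hasFDerivAt.comp_hasDerivAt (t : ℂ)
    (hasDerivAt_exp_smul_const (𝕂 := ℂ) X (t : ℂ))
  have h2 := HasDerivAt.scomp t h (Complex.ofRealCLM.hasDerivAt (x := t))
  exact h2.congr_deriv (one_smul ℂ _)

/-- A solution of `v' = X v + h` is, after pulling it back by the flow of `X`, a primitive of the
pulled back inhomogeneity. -/
theorem hasDerivWithinAt_flow_pullback (X : Matrix q q ℂ) {z : ℝ → EuclideanSpace ℂ q}
    {h : EuclideanSpace ℂ q} {s : Set ℝ} {t r : ℝ}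
    (hz : HasDerivWithinAt z (Matrix.toEuclideanLin X (z r) + h) s r) :
    HasDerivWithinAt
      (fun r => Matrix.toEuclideanLin (NormedSpace.exp (((t - r : ℝ) : ℂ) • X)) (z r))
      (Matrix.toEuclideanLin (NormedSpace.exp (((t - r : ℝ) : ℂ) • X)) h) s r := by
  -- Expanding in the standard basis reduces the product rule for matrix times vector to scalar
  -- coordinates times the flow of fixed vectors.
  have hsum : ∀ (Y : Matrix q q ℂ) (v : EuclideanSpace ℂ q),
      Matrix.toEuclideanLin Y v =
        ∑ k, v k • Matrix.toEuclideanLin Y (EuclideanSpace.single k (1 : ℂ)) := by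
    intro Y v
    conv_lhs => rw [← (EuclideanSpace.basisFun q ℂ).sum_repr v]
    simp
  have hcoord : ∀ k, HasDerivWithinAt (fun r => z r k)
      ((Matrix.toEuclideanLin X (z r) + h) k) s r := fun k =>
    ((EuclideanSpace.proj k : EuclideanSpace ℂ q →L[ℂ] ℂ).restrictScalars ℝ).hasFDerivAt
      |>.comp_hasDerivWithinAt r hz
  have hexp : ∀ v : EuclideanSpace ℂ q, HasDerivWithinAt
      (fun r : ℝ => Matrix.toEuclideanLin (NormedSpace.exp (((t - r : ℝ) : ℂ) • X)) v)
      (-(Matrix.toEuclideanLin (NormedSpace.exp (((t - r : ℝ) : ℂ) • X) * X) v)) s r := by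
    intro v
    have h1 : HasDerivAt (fun r : ℝ => t - r) (-1) r := by
      simpa using (hasDerivAt_id r).const_sub t
    have := (HasDerivAt.scomp r (hasDerivAt_toEuclideanLin_exp X v (t - r)) h1).hasDerivWithinAt
      (s := s)
    exact this.congr_deriv (by simp)
  have key := HasDerivWithinAt.fun_sum (u := Finset.univ) fun k _ =>
    (hcoord k).fun_smul (hexp (EuclideanSpace.single k 1))
  refine (key.congr_deriv ?_).congr_of_eventuallyEq ?_ ?_
  · rw [Finset.sum_add_distrib, ← hsum, map_add, ← toEuclideanLin_mul]
    simp only [smul_neg, Finset.sum_neg_distrib]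
    rw [← hsum]
    abel
  · exact Filter.Eventually.of_forall fun r => hsum _ _
  · exact hsum _ _

/-- Variation of constants without integrals: the curve exp((T - r)X) z(r) ends at z(T), its
derivative is exp((T - r)X) h(r), and its norm is compared with an explicit primitive of the
resulting bound. Right derivatives suffice, so `h` may jump at events. -/
theorem norm_le_of_exp_decay {X : Matrix q q ℂ} {bh lh : ℝ} (hbh : 0 ≤ bh)
    (hX : ExpBound X bh lh)
    {z h : ℝ → EuclideanSpace ℂ q} {T K lam : ℝ} (hT : 0 ≤ T) (hlam : lam < lh)
    (hz : ContinuousOn z (Set.Icc 0 T))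
    (hz' : ∀ t ∈ Set.Ico 0 T,
      HasDerivWithinAt z (Matrix.toEuclideanLin X (z t) + h t) (Set.Ici t) t)
    (hh : ∀ t ∈ Set.Ico 0 T, ‖h t‖ ≤ K * Real.exp (-lam * t)) :
    ‖z T‖ ≤ bh * ‖z 0‖ * Real.exp (-lh * T) +
      bh * K / (lh - lam) * (Real.exp (-lam * T) - Real.exp (-lh * T)) := by
  have hpos : 0 < lh - lam := sub_pos.2 hlam
  have hflow : ∀ r ≤ T, ∀ v : EuclideanSpace ℂ q,
      ‖Matrix.toEuclideanLin (NormedSpace.exp (((T - r : ℝ) : ℂ) • X)) v‖ ≤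
        bh * Real.exp (-lh * (T - r)) * ‖v‖ := fun r hr v =>
    (norm_toEuclideanLin_le _ v).trans
      (mul_le_mul_of_nonneg_right (hX (T - r) (sub_nonneg.2 hr)) (norm_nonneg v))
  have hcont : ContinuousOn
      (fun r : ℝ => Matrix.toEuclideanLin (NormedSpace.exp (((T - r : ℝ) : ℂ) • X)) (z r))
      (Set.Icc 0 T) := by
    have h1 : Continuous fun r : ℝ => NormedSpace.exp (((T - r : ℝ) : ℂ) • X) := by
      have : Continuous fun c : ℂ => NormedSpace.exp (c • X) :=
        continuous_iff_continuousAt.2 fun c =>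
          (hasDerivAt_exp_smul_const (𝕂 := ℂ) X c).continuousAt
      exact this.comp (by fun_prop)
    have h2 : ∀ r, Matrix.toEuclideanLin (NormedSpace.exp (((T - r : ℝ) : ℂ) • X)) (z r) =
      WithLp.toLp 2 (NormedSpace.exp (((T - r : ℝ) : ℂ) • X) *ᵥ (z r).ofLp) := fun r => rfl
    simp only [h2]
    refine (PiLp.continuous_toLp 2 _).comp_continuousOn ?_
    have h3 := continuousOn_iff_continuous_domRestrict.1 hz
    rw [continuousOn_iff_continuous_domRestrict]
    exact (h1.comp continuous_subtype_val).matrix_mulVec ((PiLp.continuous_ofLp 2 _).comp h3)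
  have hB : ∀ r : ℝ, HasDerivAt (fun r => bh * ‖z 0‖ * Real.exp (-lh * T) +
      bh * K / (lh - lam) * Real.exp (-lh * T) * (Real.exp ((lh - lam) * r) - 1))
      (bh * K * Real.exp (-lh * T) * Real.exp ((lh - lam) * r)) r := by
    intro r
    have h1 : HasDerivAt (fun r : ℝ => Real.exp ((lh - lam) * r))
        (Real.exp ((lh - lam) * r) * (lh - lam)) r := by
      simpa using ((hasDerivAt_id r).const_mul (lh - lam)).exp
    refine (((h1.sub_const 1).const_mul _).const_add _).congr_deriv ?_
    field_simp
  have main := image_norm_le_of_norm_deriv_right_le_deriv_boundary hcont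
    (fun r hr => hasDerivWithinAt_flow_pullback X (hz' r hr)) (by
      refine (hflow 0 hT (z 0)).trans (le_of_eq ?_)
      simp; ring) hB (by
      intro r hr
      refine (hflow r hr.2.le _).trans ?_
      refine (mul_le_mul_of_nonneg_left (hh r hr) (by positivity)).trans (le_of_eq ?_)
      have : Real.exp (-lh * (T - r)) * Real.exp (-lam * r) =
          Real.exp (-lh * T) * Real.exp ((lh - lam) * r) := by
        rw [← Real.exp_add, ← Real.exp_add]; ring_nf
      linear_combination bh * K * this) (Set.right_mem_Icc.2 hT)
  have hid : Matrix.toEuclideanLin (NormedSpace.exp (((T - T : ℝ) : ℂ) • X)) (z T) = z T := by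
    simp
  rw [hid] at main
  refine main.trans (le_of_eq ?_)
  have : Real.exp (-lh * T) * Real.exp ((lh - lam) * T) = Real.exp (-lam * T) := by
    rw [← Real.exp_add]; ring_nf
  linear_combination bh * K / (lh - lam) * this

/-- A Grönwall comparison. Adding ε exp((a + 1)r) to `φ` makes the differential inequality strict,
because a + 1 exceeds the rate `a`; then ε tends to 0. -/
theorem norm_le_of_deriv_le_linear {V : Type*} [NormedAddCommGroup V] [NormedSpace ℝ V]
    {f f' : ℝ → V} {φ g : ℝ → ℝ} {a s t : ℝ} (hst : s ≤ t)
    (hf : ContinuousOn f (Set.Icc s t))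
    (hf' : ∀ r ∈ Set.Ico s t, HasDerivWithinAt f (f' r) (Set.Ici r) r)
    (hbound : ∀ r ∈ Set.Ico s t, ‖f' r‖ ≤ a * ‖f r‖ + g r)
    (hφ : ∀ r, HasDerivAt φ (a * φ r + g r) r) (h0 : ‖f s‖ ≤ φ s) : ‖f t‖ ≤ φ t := by
  have key : ∀ ε > 0, ‖f t‖ ≤ φ t + ε * Real.exp ((a + 1) * t) := by
    intro ε hε
    refine image_norm_le_of_norm_deriv_right_lt_deriv_boundary hf hf'
      (B := fun r => φ r + ε * Real.exp ((a + 1) * r))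
      (B' := fun r => a * φ r + g r + ε * (Real.exp ((a + 1) * r) * (a + 1))) ?_ ?_ ?_
      (Set.right_mem_Icc.2 hst)
    · have := Real.exp_pos ((a + 1) * s)
      nlinarith
    · intro r
      have h1 : HasDerivAt (fun r : ℝ => Real.exp ((a + 1) * r))
          (Real.exp ((a + 1) * r) * (a + 1)) r := by
        simpa using ((hasDerivAt_id r).const_mul (a + 1)).exp
      exact (hφ r).fun_add (h1.const_mul ε)
    · intro r hr heq
      refine (hbound r hr).trans_lt ?_
      rw [heq]
      have := mul_pos hε (Real.exp_pos ((a + 1) * r))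
      nlinarith
  have hlim : Tendsto (fun ε : ℝ => φ t + ε * Real.exp ((a + 1) * t)) (𝓝[>] 0) (𝓝 (φ t)) := by
    have : Tendsto (fun ε : ℝ => φ t + ε * Real.exp ((a + 1) * t)) (𝓝 0)
        (𝓝 (φ t + 0 * Real.exp ((a + 1) * t))) := Continuous.tendsto (by fun_prop) 0
    simpa using this.mono_left nhdsWithin_le_nhds
  exact ge_of_tendsto hlim (eventually_mem_nhdsWithin.mono fun ε hε => key ε hε)

end LinearODE

/-! ### Lyapunov functions and exponential bounds. -/

section Lyapunov

open scoped ComplexOrder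

variable {q : Type*} [Fintype q]

theorem re_star_dotProduct_le [DecidableEq q] (X : Matrix q q ℂ) (v : EuclideanSpace ℂ q) :
    (star v.ofLp ⬝ᵥ X *ᵥ v.ofLp).re ≤ ‖X‖ * ‖v‖ ^ 2 := by
  have h : star v.ofLp ⬝ᵥ X *ᵥ v.ofLp = inner ℂ v (Matrix.toEuclideanLin X v) := by
    rw [EuclideanSpace.inner_eq_star_dotProduct, dotProduct_comm]; rfl
  rw [h]
  calc _ ≤ ‖inner ℂ v (Matrix.toEuclideanLin X v)‖ := Complex.re_le_norm _
    _ ≤ ‖v‖ * ‖Matrix.toEuclideanLin X v‖ := norm_inner_le_norm _ _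
    _ ≤ ‖v‖ * (‖X‖ * ‖v‖) := by gcongr; exact norm_toEuclideanLin_le X v
    _ = _ := by ring

theorem exists_pos_le_re_star_dotProduct {W : Matrix q q ℂ} (hW : W.PosDef) :
    ∃ δ : ℝ, 0 < δ ∧ ∀ v : EuclideanSpace ℂ q,
      δ * ‖v‖ ^ 2 ≤ (star v.ofLp ⬝ᵥ W *ᵥ v.ofLp).re := by
  -- The constant is the minimum of the form on the unit sphere, extended by homogeneity; the sphere
  -- is empty when the index type is.
  rcases (Metric.sphere (0 : EuclideanSpace ℂ q) 1).eq_empty_or_nonempty with he | hne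
  · refine ⟨1, one_pos, fun v => ?_⟩
    have : v = 0 := by
      by_contra hv
      have : ((‖v‖⁻¹ : ℂ) • v) ∈ Metric.sphere (0 : EuclideanSpace ℂ q) 1 := by
        simp [norm_smul, hv]
      simp [he] at this
    simp [this]
  · have hc : Continuous fun v : EuclideanSpace ℂ q => (star v.ofLp ⬝ᵥ W *ᵥ v.ofLp).re := by
      have := PiLp.continuous_ofLp 2 (fun _ : q => ℂ)
      exact Complex.continuous_re.comp
        ((continuous_star.comp this).dotProduct (continuous_const.matrix_mulVec this))
    obtain ⟨u, hu, hmin⟩ := (isCompact_sphere (0 : EuclideanSpace ℂ q) 1).exists_isMinOn hne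
      hc.continuousOn
    have hu0 : u.ofLp ≠ 0 := by
      intro h
      have : u = 0 := by ext i; simp [h]
      simp [this] at hu
    refine ⟨_, hW.re_dotProduct_pos hu0, fun v => ?_⟩
    by_cases hv : v = 0
    · simp [hv]
    have hmem : ((‖v‖⁻¹ : ℂ) • v) ∈ Metric.sphere (0 : EuclideanSpace ℂ q) 1 := by
      simp [norm_smul, hv]
    have h1 := hmin hmem
    have h2 : (star ((‖v‖⁻¹ : ℂ) • v).ofLp ⬝ᵥ W *ᵥ ((‖v‖⁻¹ : ℂ) • v).ofLp).re =
        (‖v‖ ^ 2)⁻¹ * (star v.ofLp ⬝ᵥ W *ᵥ v.ofLp).re := by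
      have h3 : (star ((‖v‖⁻¹ : ℂ) • v).ofLp ⬝ᵥ W *ᵥ ((‖v‖⁻¹ : ℂ) • v).ofLp) =
          (((‖v‖ ^ 2)⁻¹ : ℝ) : ℂ) * (star v.ofLp ⬝ᵥ W *ᵥ v.ofLp) := by
        simp [Matrix.mulVec_smul]
        ring
      rw [h3, Complex.re_ofReal_mul]
    have h4 : (star u.ofLp ⬝ᵥ W *ᵥ u.ofLp).re ≤
        (star ((‖v‖⁻¹ : ℂ) • v).ofLp ⬝ᵥ W *ᵥ ((‖v‖⁻¹ : ℂ) • v).ofLp).re := h1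
    rw [h2] at h4
    have hv2 : 0 < ‖v‖ ^ 2 := by positivity
    calc _ ≤ (‖v‖ ^ 2)⁻¹ * (star v.ofLp ⬝ᵥ W *ᵥ v.ofLp).re * ‖v‖ ^ 2 :=
          mul_le_mul_of_nonneg_right h4 hv2.le
      _ = _ := by field_simp

variable [DecidableEq q]

/-- Lyapunov's theorem: a quadratic Lyapunov function with decay rate `μ` gives an exponential
bound for the matrix exponential. -/
theorem exists_expBound_of_lyapunov {X W : Matrix q q ℂ} (hW : W.PosDef) {μ : ℝ}
    (h : ∀ v : q → ℂ, (star v ⬝ᵥ (W * X + Xᴴ * W) *ᵥ v).re ≤ -(2 * μ) * (star v ⬝ᵥ W *ᵥ v).re) :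
    ∃ bh : ℝ, 0 < bh ∧ ExpBound X bh μ := by
  obtain ⟨δ, hδ, hlow⟩ := exists_pos_le_re_star_dotProduct hW
  -- The form lies between δ‖v‖² and (‖W‖ + 1)‖v‖². The added 1 keeps `C` positive even for an empty
  -- index type.
  set C : ℝ := √((‖W‖ + 1) / δ) with hC
  have hCpos : 0 < C := Real.sqrt_pos.2 (by positivity)
  refine ⟨C, hCpos, fun t ht => ?_⟩
  rw [Matrix.l2_opNorm_def]
  refine ContinuousLinearMap.opNorm_le_bound _ (by positivity) fun v => ?_
  set w : ℝ → EuclideanSpace ℂ q :=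
    fun s => Matrix.toEuclideanLin (NormedSpace.exp ((s : ℂ) • X)) v with hw
  have hw' : ∀ s, HasDerivAt w (Matrix.toEuclideanLin X (w s)) s := by
    intro s
    refine (hasDerivAt_toEuclideanLin_exp X v s).congr_deriv ?_
    rw [hw, ← toEuclideanLin_mul]
    congr 2
    exact ((Commute.refl X).smul_left (s : ℂ)).exp_left.eq
  set V : ℝ → ℝ := fun s => (star (w s).ofLp ⬝ᵥ W *ᵥ (w s).ofLp).re with hV
  have hVinner : ∀ a b : EuclideanSpace ℂ q,
      inner ℂ a (Matrix.toEuclideanLin W b) = star a.ofLp ⬝ᵥ W *ᵥ b.ofLp := by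
    intro a b
    rw [EuclideanSpace.inner_eq_star_dotProduct, dotProduct_comm]; rfl
  have hV' : ∀ s, HasDerivAt V
      ((star (w s).ofLp ⬝ᵥ (W * X + Xᴴ * W) *ᵥ (w s).ofLp).re) s := by
    intro s
    have h1 : HasDerivAt (fun s => Matrix.toEuclideanLin W (w s))
        (Matrix.toEuclideanLin W (Matrix.toEuclideanLin X (w s))) s :=
      ((LinearMap.toContinuousLinearMap (Matrix.toEuclideanLin W)).restrictScalars ℝ).hasFDerivAt
        |>.comp_hasDerivAt s (hw' s)
    have h2 := (hw' s).inner ℂ h1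
    have h3 := Complex.reCLM.hasFDerivAt.comp_hasDerivAt s h2
    have h4 : V = Complex.reCLM ∘ fun s => inner ℂ (w s) (Matrix.toEuclideanLin W (w s)) := by
      funext s; simp [hV, hVinner]
    rw [h4]
    refine h3.congr_deriv ?_
    rw [hVinner, hVinner]
    simp only [Matrix.ofLp_toLpLin, Matrix.toLin'_apply, Matrix.star_mulVec, Matrix.add_mulVec,
      dotProduct_add, Matrix.mulVec_mulVec, Matrix.dotProduct_mulVec, Matrix.vecMul_vecMul,
      Complex.reCLM_apply]
  have hanti : Antitone fun s => V s * Real.exp (2 * μ * s) := by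
    refine antitone_of_hasDerivAt_nonpos
      (f' := fun s => ((star (w s).ofLp ⬝ᵥ (W * X + Xᴴ * W) *ᵥ (w s).ofLp).re) *
        Real.exp (2 * μ * s) + V s * (Real.exp (2 * μ * s) * (2 * μ))) (fun s => ?_) fun s => ?_
    · have h1 : HasDerivAt (fun r : ℝ => Real.exp (2 * μ * r))
          (Real.exp (2 * μ * s) * (2 * μ)) s := by
        simpa using ((hasDerivAt_id s).const_mul (2 * μ)).exp
      exact (hV' s).fun_mul h1
    · have h1 := h (w s).ofLp
      have h2 := Real.exp_pos (2 * μ * s)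
      simp only [hV, Pi.zero_apply]
      nlinarith
  have h0 := hanti ht
  have hw0 : w 0 = v := by simp [hw]
  have hV0 : V 0 ≤ (‖W‖ + 1) * ‖v‖ ^ 2 := by
    have := re_star_dotProduct_le W v
    simp only [hV, hw0]
    nlinarith [sq_nonneg ‖v‖]
  have hVt : δ * ‖w t‖ ^ 2 ≤ V t := hlow (w t)
  simp only [mul_zero, Real.exp_zero, mul_one] at h0
  have hE := Real.exp_pos (2 * μ * t)
  have hsq : ‖w t‖ ^ 2 ≤ (C * Real.exp (-μ * t) * ‖v‖) ^ 2 := by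
    have hC2 : C ^ 2 = (‖W‖ + 1) / δ := Real.sq_sqrt (by positivity)
    have he : Real.exp (-μ * t) ^ 2 * Real.exp (2 * μ * t) = 1 := by
      rw [← Real.exp_nat_mul, ← Real.exp_add]; simp; ring
    have h5 : δ * ‖w t‖ ^ 2 * Real.exp (2 * μ * t) ≤ (‖W‖ + 1) * ‖v‖ ^ 2 :=
      (mul_le_mul_of_nonneg_right hVt hE.le).trans (h0.trans hV0)
    have h6 : (C * Real.exp (-μ * t) * ‖v‖) ^ 2 * (δ * Real.exp (2 * μ * t)) =
        (‖W‖ + 1) * ‖v‖ ^ 2 := by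
      have h7 : (‖W‖ + 1) / δ * δ = ‖W‖ + 1 := div_mul_cancel₀ _ hδ.ne'
      rw [mul_pow, mul_pow, hC2]
      linear_combination Real.exp (-μ * t) ^ 2 * ‖v‖ ^ 2 * Real.exp (2 * μ * t) * h7 +
        (‖W‖ + 1) * ‖v‖ ^ 2 * he
    have : 0 < δ * Real.exp (2 * μ * t) := by positivity
    refine le_of_mul_le_mul_right ?_ this
    rw [h6]; linarith
  exact abs_le_of_sq_le_sq' hsq (by positivity) |>.2

theorem ExpBound.conj {X D : Matrix q q ℂ} (hD : IsUnit D) {bh lh : ℝ}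
    (h : ExpBound (D * X * D⁻¹) bh lh) : ExpBound X (‖D⁻¹‖ * bh * ‖D‖) lh := by
  intro t ht
  have hdet : IsUnit D.det := (Matrix.isUnit_iff_isUnit_det D).1 hD
  have h1 : NormedSpace.exp ((t : ℂ) • (D * X * D⁻¹)) =
      D * NormedSpace.exp ((t : ℂ) • X) * D⁻¹ := by
    rw [← Matrix.exp_conj _ _ hD]; simp
  have h2 : NormedSpace.exp ((t : ℂ) • X) =
      D⁻¹ * NormedSpace.exp ((t : ℂ) • (D * X * D⁻¹)) * D := by
    rw [h1]
    simp only [← mul_assoc, Matrix.nonsing_inv_mul D hdet, one_mul]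
    rw [mul_assoc, Matrix.nonsing_inv_mul D hdet, mul_one]
  rw [h2]
  calc _ ≤ ‖D⁻¹‖ * ‖NormedSpace.exp ((t : ℂ) • (D * X * D⁻¹))‖ * ‖D‖ :=
        (norm_mul_le _ _).trans (by gcongr; exact norm_mul_le _ _)
    _ ≤ ‖D⁻¹‖ * (bh * Real.exp (-lh * t)) * ‖D‖ := by gcongr; exact h t ht
    _ = _ := by ring

end Lyapunov

/-! ### Kernel and spectrum of the Laplacian. -/

section LaplacianSpectrum

variable {N : ℕ} (G : Digraph (Fin N))

theorem mem_neighbors {i j : Fin N} : j ∈ neighbors G i ↔ G.Adj j i := by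
  simp [neighbors]

theorem sum_adjacency_smul {V : Type*} [AddCommGroup V] [Module ℝ V] (i : Fin N)
    (v : Fin N → V) : ∑ j, adjacency G i j • v j = ∑ j ∈ neighbors G i, v j := by
  classical
  simp [adjacency, neighbors, Finset.sum_filter, ite_smul]

theorem sum_laplacian_smul {V : Type*} [AddCommGroup V] [Module ℝ V] (i : Fin N)
    (v : Fin N → V) :
    ∑ j, laplacian G i j • v j = ∑ j ∈ neighbors G i, (v i - v j) := by
  have h : ∀ j ∈ neighbors G i, adjacency G i j = 1 := by
    intro j hj
    simp [adjacency, (mem_neighbors G).1 hj]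
  have hd : ∑ j ∈ neighbors G i, adjacency G i j = ((neighbors G i).card : ℝ) := by
    rw [Finset.sum_congr rfl h]; simp
  simp only [laplacian, Matrix.sub_apply, sub_smul, Finset.sum_sub_distrib, sum_adjacency_smul]
  congr 1
  simp [Matrix.diagonal_apply, hd, Nat.cast_smul_eq_nsmul]

theorem toC_laplacian_mulVec (v : Fin N → ℂ) (i : Fin N) :
    (toC (laplacian G) *ᵥ v) i = ∑ j ∈ neighbors G i, (v i - v j) := by
  rw [← sum_laplacian_smul]
  simp [Matrix.mulVec, dotProduct, toC]

variable {G}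

/-- Maximum principle: at a maximizer the summands are nonnegative with sum zero, so all its
in-neighbors are maximizers too. Walking backwards along a path from the root to a maximizer reaches
the root. -/
theorem root_maximizes {w : Fin N → ℝ} {r : Fin N}
    (hr : ∀ v, Relation.ReflTransGen G.Adj r v)
    (hw : ∀ i, ∑ j ∈ neighbors G i, (w i - w j) = 0) (i : Fin N) : w i ≤ w r := by
  obtain ⟨m, -, hm⟩ := Finset.exists_max_image Finset.univ w ⟨r, Finset.mem_univ r⟩
  have key : w r = w m := by
    refine Relation.ReflTransGen.head_induction_on (motive := fun a _ => w a = w m) (hr m) rfl ?_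
    intro a b hab _ hb
    have h0 := (Finset.sum_eq_zero_iff_of_nonneg fun j _ => by
      have := hm j (Finset.mem_univ j)
      rw [hb]; linarith).1 (hw b) a ((mem_neighbors G).2 hab)
    linarith
  rw [key]
  exact hm i (Finset.mem_univ i)

theorem constant_of_harmonic {w : Fin N → ℝ} {r : Fin N}
    (hr : ∀ v, Relation.ReflTransGen G.Adj r v)
    (hw : ∀ i, ∑ j ∈ neighbors G i, (w i - w j) = 0) (i : Fin N) : w i = w r := by
  refine le_antisymm (root_maximizes hr hw i) ?_
  have := root_maximizes (w := fun i => -w i) hr (fun i => by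
    rw [← neg_eq_zero, ← Finset.sum_neg_distrib, ← hw i]
    exact Finset.sum_congr rfl fun j _ => by ring) i
  linarith

/-- With a directed spanning tree, the kernel of the Laplacian consists of constant vectors. -/
theorem HasSpanningTree.eq_of_laplacian_mulVec_eq_zero (hG : HasSpanningTree G)
    {v : Fin N → ℂ} (hv : toC (laplacian G) *ᵥ v = 0) (i j : Fin N) : v i = v j := by
  obtain ⟨r, hr⟩ := hG
  have h : ∀ i, ∑ j ∈ neighbors G i, (v i - v j) = 0 := fun i => by
    rw [← toC_laplacian_mulVec, hv]; rfl
  have hre : ∀ i, (v i).re = (v r).re :=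
    constant_of_harmonic (w := fun i => (v i).re) hr fun i => by
    simpa using congrArg Complex.re (h i)
  have him : ∀ i, (v i).im = (v r).im :=
    constant_of_harmonic (w := fun i => (v i).im) hr fun i => by
    simpa using congrArg Complex.im (h i)
  exact Complex.ext ((hre i).trans (hre j).symm) ((him i).trans (him j).symm)

theorem adjacency_nonneg (i j : Fin N) : 0 ≤ adjacency G i j := by
  classical
  simp only [adjacency, Matrix.of_apply]
  split_ifs <;> norm_num

/-- Row sums vanish and off-diagonal entries are nonpositive, so each Gershgorin disc has center d ≥
0 and radius d. Such a disc meets the closed left half-plane only at 0. -/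
theorem re_pos_of_laplacian_hasEigenvalue {μ : ℂ}
    (hμ : Module.End.HasEigenvalue (Matrix.toLin' (toC (laplacian G))) μ) (h0 : μ ≠ 0) :
    0 < μ.re := by
  obtain ⟨k, hk⟩ := eigenvalue_mem_ball hμ
  have hoff : ∀ j ∈ Finset.univ.erase k, ‖toC (laplacian G) k j‖ = -laplacian G k j := by
    intro j hj
    have hne : k ≠ j := (Finset.ne_of_mem_erase hj).symm
    have : laplacian G k j = -adjacency G k j := by simp [laplacian, hne]
    simp [toC, this, abs_of_nonneg (adjacency_nonneg (G := G) k j)]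
  have hrow : ∑ j, laplacian G k j = 0 := by
    simpa using sum_laplacian_smul G k (fun _ => (1 : ℝ))
  have hd : ∑ j ∈ Finset.univ.erase k, ‖toC (laplacian G) k j‖ = laplacian G k k := by
    rw [Finset.sum_congr rfl hoff, Finset.sum_neg_distrib]
    have := Finset.add_sum_erase Finset.univ (fun j => laplacian G k j) (Finset.mem_univ k)
    linarith
  have hd0 : 0 ≤ laplacian G k k := hd ▸ Finset.sum_nonneg fun _ _ => norm_nonneg _
  rw [hd, Metric.mem_closedBall, dist_eq_norm] at hk
  set d := laplacian G k k with hddef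
  have hkk : toC (laplacian G) k k = (d : ℂ) := rfl
  rw [hkk] at hk
  have hsq : (μ.re - d) ^ 2 + μ.im ^ 2 ≤ d ^ 2 := by
    have h1 : ‖μ - d‖ ^ 2 = (μ.re - d) ^ 2 + μ.im ^ 2 := by
      rw [Complex.sq_norm, Complex.normSq_apply]; simp; ring
    rw [← h1]
    exact pow_le_pow_left₀ (norm_nonneg _) hk 2
  by_contra hneg
  push Not at hneg
  have hre : μ.re = 0 := by nlinarith [sq_nonneg μ.im, sq_nonneg μ.re]
  have him : μ.im = 0 := by
    rw [hre] at hsq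
    nlinarith [sq_nonneg μ.im]
  exact h0 (Complex.ext hre him)

end LaplacianSpectrum

/-! ### Diagonal entries of `J` as nonzero Laplacian eigenvalues. -/

section JordanTransform

variable {M : ℕ} {G : Digraph (Fin (M + 1))} {SL : Matrix (Fin (M + 1)) (Fin (M + 1)) ℂ}
  {J : Matrix (Fin M) (Fin M) ℂ}

theorem IsJordanForm.isUpperTriangular (hJ : IsJordanForm J) : J.IsUpperTriangular := by
  intro i j hij
  by_contra h
  simp only [id] at hij
  rcases hJ i j h with rfl | ⟨h1, -⟩
  · exact lt_irrefl _ hij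
  · have : (j : ℕ) < i := hij
    omega

theorem IsJordanForm.exists_eigenvector (hJ : IsJordanForm J) (k : Fin M) :
    ∃ w : Fin M → ℂ, w ≠ 0 ∧ J *ᵥ w = J k k • w := by
  have hdet : (J - J k k • (1 : Matrix (Fin M) (Fin M) ℂ)).det = 0 := by
    have htri : (J - J k k • (1 : Matrix (Fin M) (Fin M) ℂ)).IsUpperTriangular := by
      intro i j hij
      have hne : i ≠ j := fun h => by simp [h] at hij
      simp [hJ.isUpperTriangular hij, Matrix.one_apply_ne hne]
    rw [Matrix.det_of_isUpperTriangular htri]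
    exact Finset.prod_eq_zero (Finset.mem_univ k) (by simp)
  obtain ⟨w, hw, h⟩ := Matrix.exists_mulVec_eq_zero_iff.2 hdet
  refine ⟨w, hw, ?_⟩
  rw [Matrix.sub_mulVec, Matrix.smul_mulVec, Matrix.one_mulVec, sub_eq_zero] at h
  exact h

theorem zeroBlock_zero (j : Fin (M + 1)) : zeroBlock J 0 j = 0 := rfl

theorem zeroBlock_succ (i : Fin M) (j : Fin (M + 1)) : zeroBlock J i.succ j = zeroCol J i j := rfl

theorem zeroCol_zero (i : Fin M) : zeroCol J i 0 = 0 := rfl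

theorem zeroCol_succ (i j : Fin M) : zeroCol J i j.succ = J i j := rfl

theorem cons_zero_zero : (Fin.cons 0 0 : Fin (M + 1) → ℂ) = 0 := by
  ext i
  refine Fin.cases ?_ (fun i => ?_) i <;> simp

theorem zeroBlock_mulVec_cons (a : ℂ) (w : Fin M → ℂ) :
    zeroBlock J *ᵥ (Fin.cons a w : Fin (M + 1) → ℂ) = Fin.cons 0 (J *ᵥ w) := by
  ext i
  refine Fin.cases ?_ (fun i => ?_) i <;>
    simp [zeroBlock_zero, zeroBlock_succ, zeroCol_zero, zeroCol_succ, Matrix.mulVec, dotProduct,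
      Fin.sum_univ_succ]

namespace IsJordanTransform

theorem laplacian_mul (h : IsJordanTransform G SL J) :
    toC (laplacian G) * SL = SL * zeroBlock J := by
  rw [← h.2.2, ← mul_assoc, ← mul_assoc, Matrix.mul_nonsing_inv _ h.1, one_mul]

theorem inv_mul_laplacian (h : IsJordanTransform G SL J) :
    SL⁻¹ * toC (laplacian G) = zeroBlock J * SL⁻¹ := by
  rw [← h.2.2, mul_assoc _ SL, Matrix.mul_nonsing_inv _ h.1, mul_one]

theorem mulVec_injective (h : IsJordanTransform G SL J) : Function.Injective (SL *ᵥ ·) :=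
  Matrix.mulVec_injective_of_isUnit ((Matrix.isUnit_iff_isUnit_det _).2 h.1)

theorem hasEigenvalue_diag (h : IsJordanTransform G SL J) (k : Fin M) :
    Module.End.HasEigenvalue (Matrix.toLin' (toC (laplacian G))) (J k k) := by
  obtain ⟨w, hw, hJw⟩ := h.2.1.exists_eigenvector k
  refine Module.End.hasEigenvalue_of_hasEigenvector
    (x := SL *ᵥ (Fin.cons 0 w : Fin (M + 1) → ℂ)) ⟨?_, ?_⟩
  · rw [Module.End.mem_eigenspace_iff, Matrix.toLin'_apply, Matrix.mulVec_mulVec,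
      h.laplacian_mul, ← Matrix.mulVec_mulVec, zeroBlock_mulVec_cons, hJw, ← Matrix.mulVec_smul]
    congr 1
    ext i
    refine Fin.cases ?_ (fun i => ?_) i <;> simp
  · intro h0
    apply hw
    have : (Fin.cons 0 w : Fin (M + 1) → ℂ) = 0 := h.mulVec_injective (by simpa using h0)
    ext i
    simpa using congrFun this i.succ

theorem col_zero_constant (h : IsJordanTransform G SL J) (hG : HasSpanningTree G)
    (i j : Fin (M + 1)) : SL i 0 = SL j 0 := by
  have hz : (Fin.cons 1 0 : Fin (M + 1) → ℂ) = Pi.single 0 1 := by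
    ext i
    refine Fin.cases ?_ (fun i => ?_) i <;> simp
  have := hG.eq_of_laplacian_mulVec_eq_zero (v := SL *ᵥ (Fin.cons 1 0 : Fin (M + 1) → ℂ)) (by
    rw [Matrix.mulVec_mulVec, h.laplacian_mul, ← Matrix.mulVec_mulVec, zeroBlock_mulVec_cons,
      Matrix.mulVec_zero, cons_zero_zero, Matrix.mulVec_zero]) i j
  rw [hz] at this
  simpa using this

/-- A zero diagonal entry would give a kernel vector of the Laplacian independent of the first
column of `SL`, although the kernel is a line. -/
theorem diag_ne_zero (h : IsJordanTransform G SL J) (hG : HasSpanningTree G) (k : Fin M) :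
    J k k ≠ 0 := by
  intro hk
  obtain ⟨w, hw, hJw⟩ := h.2.1.exists_eigenvector k
  rw [hk, zero_smul] at hJw
  set v := SL *ᵥ (Fin.cons 0 w : Fin (M + 1) → ℂ) with hv
  have hLv : toC (laplacian G) *ᵥ v = 0 := by
    rw [hv, Matrix.mulVec_mulVec, h.laplacian_mul, ← Matrix.mulVec_mulVec,
      zeroBlock_mulVec_cons, hJw, cons_zero_zero, Matrix.mulVec_zero]
  have hconst := hG.eq_of_laplacian_mulVec_eq_zero hLv
  have hz : SL *ᵥ Pi.single 0 1 = fun i => SL i 0 := by ext i; simp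
  -- Both `v` and the first column of `SL` are constant, so weighting each by the value of the other
  -- cancels them.
  have hlin : SL *ᵥ (SL 0 0 • (Fin.cons 0 w : Fin (M + 1) → ℂ) - v 0 • Pi.single 0 1) = 0 := by
    rw [Matrix.mulVec_sub, Matrix.mulVec_smul, Matrix.mulVec_smul, ← hv, hz]
    ext i
    simp only [Pi.sub_apply, Pi.smul_apply, smul_eq_mul, Pi.zero_apply]
    rw [hconst i 0, h.col_zero_constant hG i 0]
    ring
  have h0 := h.mulVec_injective (hlin.trans (Matrix.mulVec_zero SL).symm)
  have hne : SL 0 0 ≠ 0 := by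
    intro h00
    have : SL *ᵥ Pi.single 0 1 = SL *ᵥ 0 := by
      rw [hz, Matrix.mulVec_zero]
      ext i
      rw [h.col_zero_constant hG i 0, h00]; rfl
    have := congrFun (h.mulVec_injective this) 0
    simp at this
  apply hw
  ext i
  have := congrFun h0 i.succ
  simpa [hne] using this

theorem re_lambdaTwo_le_re_diag (h : IsJordanTransform G SL J) (hG : HasSpanningTree G)
    {lam2 : ℂ} (h2 : IsLambdaTwo G lam2)
    (k : Fin M) : lam2.re ≤ (J k k).re :=
  h2.2.2 _ (h.hasEigenvalue_diag k) (h.diag_ne_zero hG k)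

end IsJordanTransform

theorem IsLambdaTwo.re_pos {lam2 : ℂ} (h2 : IsLambdaTwo G lam2) : 0 < lam2.re :=
  re_pos_of_laplacian_hasEigenvalue h2.1 h2.2.1

theorem IsLambdaTwo.laplacian_ne_zero {lam2 : ℂ} (h2 : IsLambdaTwo G lam2) :
    laplacian G ≠ 0 := by
  intro h
  obtain ⟨v, hv⟩ := h2.1.exists_hasEigenvector
  have h1 := hv.apply_eq_smul
  have : toC (0 : Matrix (Fin (M + 1)) (Fin (M + 1)) ℝ) = 0 := by ext; simp [toC]
  rw [h, this, map_zero, LinearMap.zero_apply] at h1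
  exact (smul_ne_zero h2.2.1 hv.2) h1.symm

end JordanTransform

/-! ### Passing from real to complex matrices. -/

section Complexification

variable {p q r : Type*}

theorem toC_mul [Fintype q] (X : Matrix p q ℝ) (Y : Matrix q r ℝ) :
    toC (X * Y) = toC X * toC Y :=
  Matrix.map_mul (f := Complex.ofRealHom)

theorem toC_conjTranspose (X : Matrix p q ℝ) : (toC X)ᴴ = toC Xᵀ := by
  ext i j; simp [toC]

theorem toC_add (X Y : Matrix p q ℝ) : toC (X + Y) = toC X + toC Y := by
  ext i j; simp [toC]

theorem toC_sub (X Y : Matrix p q ℝ) : toC (X - Y) = toC X - toC Y := by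
  ext i j; simp [toC]

theorem toC_neg (X : Matrix p q ℝ) : toC (-X) = -toC X := by
  ext i j; simp [toC]

theorem toC_smul (a : ℝ) (X : Matrix p q ℝ) : toC (a • X) = (a : ℂ) • toC X := by
  ext i j; simp [toC]

/-- Cross terms between real and imaginary parts of `v` are purely imaginary, so no symmetry of `X`
is needed. This carries definiteness from ℝ to ℂ. -/
theorem re_star_dotProduct_toC [Fintype q] (X : Matrix q q ℝ) (v : q → ℂ) :
    (star v ⬝ᵥ toC X *ᵥ v).re =
      (fun i => (v i).re) ⬝ᵥ X *ᵥ (fun i => (v i).re) +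
        (fun i => (v i).im) ⬝ᵥ X *ᵥ (fun i => (v i).im) := by
  simp [dotProduct, Matrix.mulVec, toC, Finset.sum_add_distrib]

open scoped ComplexOrder

theorem PosSemidef.toC [Fintype q] {X : Matrix q q ℝ} (hX : X.PosSemidef) :
    (toC X).PosSemidef := by
  have hH : (EventConsensus.toC X).IsHermitian := by
    rw [Matrix.IsHermitian, toC_conjTranspose]
    congr 1
    simpa [Matrix.IsHermitian] using hX.1
  refine Matrix.PosSemidef.of_dotProduct_mulVec_nonneg hH fun v => ?_
  rw [Complex.nonneg_iff]
  refine ⟨?_, (hH.im_star_dotProduct_mulVec_self v).symm⟩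
  rw [re_star_dotProduct_toC]
  exact add_nonneg (hX.dotProduct_mulVec_nonneg _) (hX.dotProduct_mulVec_nonneg _)

theorem PosDef.toC [Fintype q] {X : Matrix q q ℝ} (hX : X.PosDef) : (toC X).PosDef := by
  have hH := (PosSemidef.toC hX.posSemidef).isHermitian
  refine Matrix.PosDef.of_dotProduct_mulVec_pos hH fun v hv => ?_
  rw [Complex.pos_iff]
  refine ⟨?_, (hH.im_star_dotProduct_mulVec_self v).symm⟩
  rw [re_star_dotProduct_toC]
  by_cases hre : (fun i => (v i).re) = 0
  · have him : (fun i => (v i).im) ≠ 0 := fun him =>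
      hv (funext fun i => Complex.ext (congrFun hre i) (congrFun him i))
    exact add_pos_of_nonneg_of_pos (hX.posSemidef.dotProduct_mulVec_nonneg _)
      (hX.dotProduct_mulVec_pos him)
  · exact add_pos_of_pos_of_nonneg (hX.dotProduct_mulVec_pos hre)
      (hX.posSemidef.dotProduct_mulVec_nonneg _)

end Complexification

/-! ### Exponential stability of Â. -/

section Hurwitz

variable {M n m : ℕ} {A P : Matrix (Fin n) (Fin n) ℝ} {B : Matrix (Fin n) (Fin m) ℝ}
  {J : Matrix (Fin M) (Fin M) ℂ} {c α : ℝ}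

theorem mul_gain : B * gain B P = -(B * Bᵀ * P) := by
  simp [gain, Matrix.mul_assoc]

/-- `I ⊗ P` is a Lyapunov matrix for the block diagonal part of `Â`. -/
theorem lyapunov_blockDiagonal (hP : SolvesLMI A B α P) (hJ : ∀ k, 1 ≤ c * (J k k).re)
    (v : Fin M × Fin n → ℂ) :
    (star v ⬝ᵥ (((1 : Matrix (Fin M) (Fin M) ℂ) ⊗ₖ toC P) *
          Ahat A B (gain B P) c (Matrix.diagonal J.diag) +
        (Ahat A B (gain B P) c (Matrix.diagonal J.diag))ᴴ *
          ((1 : Matrix (Fin M) (Fin M) ℂ) ⊗ₖ toC P)) *ᵥ v).re ≤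
      -(2 * α) * (star v ⬝ᵥ ((1 : Matrix (Fin M) (Fin M) ℂ) ⊗ₖ toC P) *ᵥ v).re := by
  open scoped ComplexOrder in
  have hPs : Pᵀ = P := by simpa [Matrix.IsHermitian] using hP.1.1
  set Q := -(P * A + Aᵀ * P - (2 : ℝ) • (P * B * Bᵀ * P) + (2 * α) • P) with hQ
  set d : Fin M → ℂ := fun k => ((2 * (c * (J k k).re - 1) : ℝ) : ℂ) with hd
  have hS : (P * B * Bᵀ * P).PosSemidef := by
    have := Matrix.posSemidef_self_mul_conjTranspose (P * B)
    simpa [Matrix.conjTranspose_mul, hPs, Matrix.mul_assoc] using this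
  have hdpos : (0 : Fin M → ℂ) ≤ d := fun k => by
    have := hJ k
    simp only [hd, Pi.zero_apply]
    exact_mod_cast (by linarith : (0 : ℝ) ≤ 2 * (c * (J k k).re - 1))
  have h1 := (Matrix.PosSemidef.one (n := Fin M) (R := ℂ)).kronecker
    (PosSemidef.toC hP.2.posSemidef)
  have h2 := (Matrix.PosSemidef.diagonal hdpos).kronecker (PosSemidef.toC hS)
  -- In block k the left side is PA + AᵀP - 2c Re(J_kk) PBBᵀP, which is -Q - 2(c Re J_kk - 1) PBBᵀP
  -- - 2αP. The first two terms are negative semidefinite.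
  have key : ((1 : Matrix (Fin M) (Fin M) ℂ) ⊗ₖ toC P) *
        Ahat A B (gain B P) c (Matrix.diagonal J.diag) +
      (Ahat A B (gain B P) c (Matrix.diagonal J.diag))ᴴ *
        ((1 : Matrix (Fin M) (Fin M) ℂ) ⊗ₖ toC P) =
      -((1 : Matrix (Fin M) (Fin M) ℂ) ⊗ₖ toC Q) -
        (Matrix.diagonal d ⊗ₖ toC (P * B * Bᵀ * P)) -
        ((2 * α : ℝ) : ℂ) • ((1 : Matrix (Fin M) (Fin M) ℂ) ⊗ₖ toC P) := by
    have e1 : (Ahat A B (gain B P) c (Matrix.diagonal J.diag))ᴴ =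
        (1 : Matrix (Fin M) (Fin M) ℂ) ⊗ₖ toC Aᵀ +
          ((c : ℂ) • Matrix.diagonal (star J.diag)) ⊗ₖ toC (-(P * B * Bᵀ)) := by
      rw [Ahat, Matrix.conjTranspose_add, Matrix.conjTranspose_kronecker,
        Matrix.conjTranspose_kronecker, toC_conjTranspose, toC_conjTranspose, mul_gain]
      simp [Matrix.mul_assoc, hPs]
    rw [e1, Ahat, Matrix.mul_add, Matrix.add_mul]
    simp only [← Matrix.mul_kronecker_mul, Matrix.one_mul, Matrix.mul_one, ← toC_mul, mul_gain]
    ext ⟨i, a⟩ ⟨j, b⟩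
    have e2 : (-(P * B * Bᵀ) * P) = -(P * B * Bᵀ * P) := by simp
    have e3 : P * -(B * Bᵀ * P) = -(P * B * Bᵀ * P) := by simp [Matrix.mul_assoc]
    rw [e2, e3]
    by_cases hij : i = j
    · subst hij
      have hre : J i i + (starRingEnd ℂ) (J i i) = ((2 * (J i i).re : ℝ) : ℂ) := Complex.add_conj _
      simp only [hQ, hd, toC_neg, toC_add, toC_sub, toC_smul, Matrix.add_apply, Matrix.sub_apply,
        Matrix.neg_apply, Matrix.smul_apply, Matrix.kroneckerMap_apply, Matrix.one_apply_eq,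
        Matrix.diagonal_apply_eq, Matrix.diag_apply, Pi.star_apply, smul_eq_mul, one_mul]
      push_cast at hre ⊢
      simp only [RCLike.star_def]
      linear_combination (-(c : ℂ)) * toC (P * B * Bᵀ * P) a b * hre
    · simp [Matrix.one_apply_ne hij, hij]
  rw [key, Matrix.sub_mulVec, Matrix.sub_mulVec, Matrix.neg_mulVec, Matrix.smul_mulVec,
    dotProduct_sub, dotProduct_sub, dotProduct_neg, dotProduct_smul, smul_eq_mul, Complex.sub_re,
    Complex.sub_re, Complex.neg_re, Complex.re_ofReal_mul]
  have h3 := h1.re_dotProduct_nonneg v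
  have h4 := h2.re_dotProduct_nonneg v
  simp only [RCLike.re_eq_complex_re] at h3 h4
  linarith

/-- Entry (i, j) is multiplied by ε^(j - i), so the diagonal is kept and the superdiagonal is scaled
by ε. -/
theorem IsJordanForm.diagonal_conj (hJ : IsJordanForm J) {ε : ℝ} (hε : ε ≠ 0) :
    Matrix.diagonal (fun k : Fin M => ((ε : ℂ) ^ (k : ℕ))⁻¹) * J *
        Matrix.diagonal (fun k : Fin M => (ε : ℂ) ^ (k : ℕ)) =
      Matrix.diagonal J.diag + (ε : ℂ) • (J - Matrix.diagonal J.diag) := by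
  have hε' : (ε : ℂ) ≠ 0 := by exact_mod_cast hε
  ext i j
  rw [Matrix.mul_diagonal, Matrix.diagonal_mul]
  by_cases h : J i j = 0
  · by_cases hij : i = j
    · subst hij; simp [h]
    · simp [h, hij]
  · rcases hJ i j h with rfl | ⟨h1, -, -⟩
    · have := pow_ne_zero (j : ℕ) hε'
      simp only [Matrix.add_apply, Matrix.diagonal_apply_eq, Matrix.diag_apply, Matrix.smul_apply,
        Matrix.sub_apply, sub_self, smul_zero, add_zero]
      field_simp
    · have hij : i ≠ j := fun h => by rw [h] at h1; omega
      have := pow_ne_zero (i : ℕ) hε'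
      simp only [Matrix.add_apply, Matrix.diagonal_apply_ne _ hij, Matrix.smul_apply,
        Matrix.sub_apply, sub_zero, zero_add, h1, pow_succ, smul_eq_mul]
      field_simp

/-- `Â` is Hurwitz. -/
theorem exists_expBound_Ahat (hα : 0 < α) (hP : SolvesLMI A B α P) (hJ : IsJordanForm J)
    (hJc : ∀ k, 1 ≤ c * (J k k).re) :
    ∃ bh lh : ℝ, 0 < bh ∧ 0 < lh ∧ ExpBound (Ahat A B (gain B P) c J) bh lh := by
  open scoped ComplexOrder in
  set F := gain B P with hF
  set W : Matrix (Fin M × Fin n) (Fin M × Fin n) ℂ :=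
    (1 : Matrix (Fin M) (Fin M) ℂ) ⊗ₖ toC P with hWdef
  have hW : W.PosDef := (Matrix.PosDef.one (n := Fin M) (R := ℂ)).kronecker (PosDef.toC hP.1)
  set X := Ahat A B F c (Matrix.diagonal J.diag) with hX
  set Y : Matrix (Fin M × Fin n) (Fin M × Fin n) ℂ :=
    ((c : ℂ) • (J - Matrix.diagonal J.diag)) ⊗ₖ toC (B * F) with hY
  obtain ⟨δ, hδ, hlow⟩ := exists_pos_le_re_star_dotProduct hW
  set H := ‖W * Y + Yᴴ * W‖ with hH
  have hH0 : 0 ≤ H := norm_nonneg _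
  -- With ε H ≤ α δ, the superdiagonal part costs at most α times the Lyapunov function, leaving
  -- half of the decay rate α.
  set ε : ℝ := α * δ / (H + 1) with hεdef
  have hε : 0 < ε := by positivity
  have hεC : (ε : ℂ) ≠ 0 := by exact_mod_cast hε.ne'
  set D : Matrix (Fin M × Fin n) (Fin M × Fin n) ℂ :=
    Matrix.diagonal (fun k : Fin M => ((ε : ℂ) ^ (k : ℕ))⁻¹) ⊗ₖ
      (1 : Matrix (Fin n) (Fin n) ℂ) with hD
  set D' : Matrix (Fin M × Fin n) (Fin M × Fin n) ℂ :=
    Matrix.diagonal (fun k : Fin M => (ε : ℂ) ^ (k : ℕ)) ⊗ₖ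
      (1 : Matrix (Fin n) (Fin n) ℂ) with hD'
  have hdd : Matrix.diagonal (fun k : Fin M => ((ε : ℂ) ^ (k : ℕ))⁻¹) *
      Matrix.diagonal (fun k : Fin M => (ε : ℂ) ^ (k : ℕ)) = 1 := by
    rw [Matrix.diagonal_mul_diagonal, ← Matrix.diagonal_one]
    congr 1
    funext k
    exact inv_mul_cancel₀ (pow_ne_zero _ hεC)
  have hDD : D * D' = 1 := by
    rw [hD, hD', ← Matrix.mul_kronecker_mul, hdd, one_mul, Matrix.one_kronecker_one]
  have hDinv : D⁻¹ = D' := Matrix.inv_eq_right_inv hDD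
  have hDu : IsUnit D := IsUnit.of_mul_eq_one D' hDD
  have hconj : D * Ahat A B F c J * D⁻¹ = X + (ε : ℂ) • Y := by
    rw [hDinv, hD, hD', hX, hY, Ahat, Ahat, Matrix.mul_add, Matrix.add_mul]
    simp only [← Matrix.mul_kronecker_mul, one_mul, mul_one, hdd]
    rw [Matrix.mul_smul, Matrix.smul_mul, hJ.diagonal_conj hε.ne', add_assoc, smul_add,
      Matrix.add_kronecker, smul_comm (c : ℂ) (ε : ℂ), Matrix.smul_kronecker (ε : ℂ)]
  have hlyap0 : ∀ v : Fin M × Fin n → ℂ, (star v ⬝ᵥ (W * X + Xᴴ * W) *ᵥ v).re ≤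
      -(2 * α) * (star v ⬝ᵥ W *ᵥ v).re := lyapunov_blockDiagonal hP hJc
  clear_value W X Y D D' ε
  have hlyap : ∀ v : Fin M × Fin n → ℂ,
      (star v ⬝ᵥ (W * (X + (ε : ℂ) • Y) + (X + (ε : ℂ) • Y)ᴴ * W) *ᵥ v).re ≤
        -(2 * (α / 2)) * (star v ⬝ᵥ W *ᵥ v).re := by
    intro v
    have e : W * (X + (ε : ℂ) • Y) + (X + (ε : ℂ) • Y)ᴴ * W =
        (W * X + Xᴴ * W) + (ε : ℂ) • (W * Y + Yᴴ * W) := by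
      simp only [Matrix.conjTranspose_add, Matrix.conjTranspose_smul, Matrix.mul_add,
        Matrix.add_mul, Matrix.mul_smul, Matrix.smul_mul, smul_add, RCLike.star_def,
        Complex.conj_ofReal]
      abel
    have h1 := hlyap0 v
    have h2 := re_star_dotProduct_le (W * Y + Yᴴ * W) (WithLp.toLp 2 v)
    have h3 := hlow (WithLp.toLp 2 v)
    rw [e, Matrix.add_mulVec, Matrix.smul_mulVec, dotProduct_add, dotProduct_smul, smul_eq_mul,
      Complex.add_re, Complex.re_ofReal_mul]
    simp only [← hH] at h2
    set nv := ‖(WithLp.toLp 2 v : EuclideanSpace ℂ (Fin M × Fin n))‖ ^ 2 with hnv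
    have hnv0 : 0 ≤ nv := by positivity
    have h4 : ε * H ≤ α * δ := by
      rw [hεdef, div_mul_eq_mul_div, div_le_iff₀ (by positivity)]
      nlinarith [mul_pos hα hδ]
    have h2' : (star v ⬝ᵥ (W * Y + Yᴴ * W) *ᵥ v).re ≤ H * nv := h2
    have h3' : δ * nv ≤ (star v ⬝ᵥ W *ᵥ v).re := h3
    have h5 : ε * (star v ⬝ᵥ (W * Y + Yᴴ * W) *ᵥ v).re ≤ ε * (H * nv) :=
      mul_le_mul_of_nonneg_left h2' hε.le
    have h6 : ε * H * nv ≤ α * δ * nv := mul_le_mul_of_nonneg_right h4 hnv0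
    have h7 : α * (δ * nv) ≤ α * (star v ⬝ᵥ W *ᵥ v).re := mul_le_mul_of_nonneg_left h3' hα.le
    linarith
  obtain ⟨b, hb, hbound⟩ := exists_expBound_of_lyapunov hW hlyap
  rw [← hconj] at hbound
  -- The added 1 gives positivity without excluding an empty index type, where the norms vanish.
  refine ⟨‖D⁻¹‖ * b * ‖D‖ + 1, α / 2, by positivity, by positivity, fun t ht => ?_⟩
  refine (hbound.conj hDu t ht).trans ?_
  gcongr
  linarith

end Hurwitz

/-! ### Stacked vectors and Kronecker products. -/

section Stack

/-- `X ⊗ₖ 1` acts by `X` on each slice `v (·, a)` separately, and the squared norms of the slices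
add up. -/
theorem norm_toEuclideanLin_kronecker_one_le {𝕜 p q r : Type*} [RCLike 𝕜] [Fintype p] [Fintype q]
    [DecidableEq q] [Fintype r] [DecidableEq r] (X : Matrix p q 𝕜)
    (v : EuclideanSpace 𝕜 (q × r)) :
    ‖Matrix.toEuclideanLin (X ⊗ₖ (1 : Matrix r r 𝕜)) v‖ ≤ ‖X‖ * ‖v‖ := by
  have hsq : ‖Matrix.toEuclideanLin (X ⊗ₖ (1 : Matrix r r 𝕜)) v‖ ^ 2 ≤ (‖X‖ * ‖v‖) ^ 2 := by
    have hentry : ∀ i a, Matrix.toEuclideanLin (X ⊗ₖ (1 : Matrix r r 𝕜)) v (i, a) =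
        Matrix.toEuclideanLin X (WithLp.toLp 2 fun j => v (j, a)) i := by
      intro i a
      simp [Matrix.toLpLin_apply, Matrix.mulVec, dotProduct, Fintype.sum_prod_type,
        Matrix.one_apply]
    have hv : ‖v‖ ^ 2 = ∑ a, ‖(WithLp.toLp 2 fun j => v (j, a) : EuclideanSpace 𝕜 q)‖ ^ 2 := by
      simp only [EuclideanSpace.norm_sq_eq, Fintype.sum_prod_type]
      exact Finset.sum_comm
    have hXv : ‖Matrix.toEuclideanLin (X ⊗ₖ (1 : Matrix r r 𝕜)) v‖ ^ 2 =
        ∑ a, ‖Matrix.toEuclideanLin X (WithLp.toLp 2 fun j => v (j, a))‖ ^ 2 := by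
      simp only [EuclideanSpace.norm_sq_eq, Fintype.sum_prod_type, hentry]
      exact Finset.sum_comm
    rw [hXv, mul_pow, hv, Finset.mul_sum]
    refine Finset.sum_le_sum fun a _ => ?_
    rw [← mul_pow]
    exact pow_le_pow_left₀ (norm_nonneg _) (norm_toEuclideanLin_le X _) 2
  exact abs_le_of_sq_le_sq' hsq (by positivity) |>.2

variable {N n : ℕ}

/-- The stacked vector of a family of vectors. -/
def stackR (v : Fin N → EuclideanSpace ℝ (Fin n)) : EuclideanSpace ℝ (Fin N × Fin n) :=
  WithLp.toLp 2 fun q => v q.1 q.2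

/-- The stacked vector of a family of real vectors, as a complex vector. -/
def stackC (v : Fin N → EuclideanSpace ℝ (Fin n)) : EuclideanSpace ℂ (Fin N × Fin n) :=
  WithLp.toLp 2 fun q => ((v q.1 q.2 : ℝ) : ℂ)

theorem norm_stackR_sq (v : Fin N → EuclideanSpace ℝ (Fin n)) :
    ‖stackR v‖ ^ 2 = ∑ i, ‖v i‖ ^ 2 := by
  simp [EuclideanSpace.norm_sq_eq, Fintype.sum_prod_type, stackR]

theorem norm_stackC (v : Fin N → EuclideanSpace ℝ (Fin n)) : ‖stackC v‖ = ‖stackR v‖ := by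
  simp [EuclideanSpace.norm_eq, stackR, stackC]

theorem norm_le_norm_stackR (v : Fin N → EuclideanSpace ℝ (Fin n)) (i : Fin N) :
    ‖v i‖ ≤ ‖stackR v‖ := by
  have : ‖v i‖ ^ 2 ≤ ‖stackR v‖ ^ 2 := by
    rw [norm_stackR_sq]
    exact Finset.single_le_sum (f := fun i => ‖v i‖ ^ 2) (fun _ _ => by positivity)
      (Finset.mem_univ i)
  exact abs_le_of_sq_le_sq' this (norm_nonneg _) |>.2

theorem norm_stackR_le {v : Fin N → EuclideanSpace ℝ (Fin n)} {b : ℝ} (hb : 0 ≤ b)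
    (h : ∀ i, ‖v i‖ ≤ b) : ‖stackR v‖ ≤ √(N : ℝ) * b := by
  have : ‖stackR v‖ ^ 2 ≤ (√(N : ℝ) * b) ^ 2 := by
    rw [norm_stackR_sq, mul_pow, Real.sq_sqrt (Nat.cast_nonneg _)]
    calc _ ≤ ∑ _i : Fin N, b ^ 2 :=
          Finset.sum_le_sum fun i _ => pow_le_pow_left₀ (norm_nonneg _) (h i) 2
      _ = _ := by simp
  exact abs_le_of_sq_le_sq' this (by positivity) |>.2

/-- The differences `∑ j ∈ 𝓝 i, (v i - v j)`, that is, the Laplacian applied to `v`. -/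
noncomputable def disagreement (G : Digraph (Fin N)) (v : Fin N → EuclideanSpace ℝ (Fin n))
    (i : Fin N) : EuclideanSpace ℝ (Fin n) :=
  ∑ j ∈ neighbors G i, (v i - v j)

variable (G : Digraph (Fin N))

theorem disagreement_apply (v : Fin N → EuclideanSpace ℝ (Fin n)) (i : Fin N) (a : Fin n) :
    disagreement G v i a = ∑ j, laplacian G i j * v j a := by
  rw [disagreement, ← sum_laplacian_smul]
  simp

theorem disagreement_add (v w : Fin N → EuclideanSpace ℝ (Fin n)) (i : Fin N) :
    disagreement G (v + w) i = disagreement G v i + disagreement G w i := by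
  simp only [disagreement, ← Finset.sum_add_distrib]
  exact Finset.sum_congr rfl fun j _ => by simp only [Pi.add_apply]; abel

theorem stackR_disagreement (v : Fin N → EuclideanSpace ℝ (Fin n)) :
    stackR (disagreement G v) =
      Matrix.toEuclideanLin (laplacian G ⊗ₖ (1 : Matrix (Fin n) (Fin n) ℝ)) (stackR v) := by
  ext ⟨i, a⟩
  simp [stackR, disagreement_apply, Matrix.toLpLin_apply, Matrix.mulVec, dotProduct,
    Fintype.sum_prod_type, Matrix.one_apply]

theorem stackC_disagreement (v : Fin N → EuclideanSpace ℝ (Fin n)) :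
    stackC (disagreement G v) =
      Matrix.toEuclideanLin (toC (laplacian G) ⊗ₖ (1 : Matrix (Fin n) (Fin n) ℂ)) (stackC v) := by
  ext ⟨i, a⟩
  simp [stackC, disagreement_apply, Matrix.toLpLin_apply, Matrix.mulVec, dotProduct, toC,
    Fintype.sum_prod_type, Matrix.one_apply]

theorem stackC_map {n' : ℕ} (X : Matrix (Fin n') (Fin n) ℝ)
    (v : Fin N → EuclideanSpace ℝ (Fin n)) :
    stackC (fun i => Matrix.toEuclideanLin X (v i)) =
      Matrix.toEuclideanLin ((1 : Matrix (Fin N) (Fin N) ℂ) ⊗ₖ toC X) (stackC v) := by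
  ext ⟨i, a⟩
  simp [stackC, Matrix.toLpLin_apply, Matrix.mulVec, dotProduct, toC,
    Fintype.sum_prod_type, Matrix.one_apply]

theorem stackC_add (v w : Fin N → EuclideanSpace ℝ (Fin n)) :
    stackC (v + w) = stackC v + stackC w := by
  ext; simp [stackC]

theorem stackC_smul (a : ℝ) (v : Fin N → EuclideanSpace ℝ (Fin n)) :
    stackC (a • v) = (a : ℂ) • stackC v := by
  ext; simp [stackC]

theorem toEuclideanLin_input {m : ℕ} (c : ℝ) (B : Matrix (Fin n) (Fin m) ℝ)
    (F : Matrix (Fin m) (Fin n) ℝ) (y : Fin N → EuclideanSpace ℝ (Fin n)) (i : Fin N) :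
    Matrix.toEuclideanLin B (input G c F y i) =
      Matrix.toEuclideanLin (c • (B * F)) (disagreement G y i) := by
  rw [input, map_smul, ← toEuclideanLin_mul, map_smul, LinearMap.smul_apply, disagreement]

end Stack

/-! ### The closed loop in the coordinates x̂. -/

section Transform

variable {M n m : ℕ} {G : Digraph (Fin (M + 1))} {SL : Matrix (Fin (M + 1)) (Fin (M + 1)) ℂ}
  {J : Matrix (Fin M) (Fin M) ℂ}

/-- The matrix `S⁻¹` without its first row. -/
noncomputable def invTail (SL : Matrix (Fin (M + 1)) (Fin (M + 1)) ℂ) :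
    Matrix (Fin M) (Fin (M + 1)) ℂ :=
  SL⁻¹.submatrix Fin.succ id

theorem zeroCol_mul (X : Matrix (Fin (M + 1)) (Fin (M + 1)) ℂ) :
    zeroCol J * X = J * X.submatrix Fin.succ id := by
  ext i j
  simp [Matrix.mul_apply, Fin.sum_univ_succ, zeroCol_zero, zeroCol_succ]

theorem zeroRow_zero (j : Fin M) : zeroRow J 0 j = 0 := rfl

theorem zeroRow_succ (i j : Fin M) : zeroRow J i.succ j = J i j := rfl

theorem zeroBlock_mul (X : Matrix (Fin (M + 1)) (Fin (M + 1)) ℂ) :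
    zeroBlock J * X = zeroRow J * X.submatrix Fin.succ id := by
  ext i j
  refine Fin.cases ?_ (fun i => ?_) i
  · simp [Matrix.mul_apply, zeroBlock_zero, zeroRow_zero]
  · have := congrFun (congrFun (zeroCol_mul (J := J) X) i) j
    simpa [Matrix.mul_apply, zeroBlock_succ, zeroRow_succ] using this

theorem Delta_eq : Delta SL J = J * invTail SL := zeroCol_mul _

theorem IsJordanTransform.invTail_mul_laplacian (h : IsJordanTransform G SL J) :
    invTail SL * toC (laplacian G) = Delta SL J := by
  have h1 := h.inv_mul_laplacian
  ext i j
  have := congrFun (congrFun h1 i.succ) j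
  simpa [Matrix.mul_apply, zeroBlock_succ, Delta, invTail] using this

/-- The Laplacian factors through x̂ because the first column of diag(0, J) vanishes; this is how
`Theta` enters K₁ and K₂. -/
theorem IsJordanTransform.Theta_mul_invTail (h : IsJordanTransform G SL J) :
    Theta SL J * invTail SL = toC (laplacian G) := by
  rw [Theta, invTail, Matrix.mul_assoc, ← zeroBlock_mul, ← h.inv_mul_laplacian, ← Matrix.mul_assoc,
    Matrix.mul_nonsing_inv _ h.1, Matrix.one_mul]

theorem xhatTail_eq (v : Fin (M + 1) → EuclideanSpace ℝ (Fin n)) :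
    xhatTail SL v =
      Matrix.toEuclideanLin (invTail SL ⊗ₖ (1 : Matrix (Fin n) (Fin n) ℂ)) (stackC v) := by
  ext ⟨k, a⟩
  rw [xhatTail, Matrix.inv_kronecker, inv_one]
  simp [invTail, stackC, Matrix.toLpLin_apply, Matrix.mulVec, dotProduct]

theorem IsJordanTransform.stackC_disagreement (h : IsJordanTransform G SL J)
    (v : Fin (M + 1) → EuclideanSpace ℝ (Fin n)) :
    stackC (disagreement G v) =
      Matrix.toEuclideanLin (Theta SL J ⊗ₖ (1 : Matrix (Fin n) (Fin n) ℂ)) (xhatTail SL v) := by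
  rw [EventConsensus.stackC_disagreement, xhatTail_eq, ← toEuclideanLin_mul,
    ← Matrix.mul_kronecker_mul, h.Theta_mul_invTail, Matrix.one_mul]

/-- The transformed closed loop: `x̂' = Â x̂ + B̂ e`. -/
theorem IsJordanTransform.xhatTail_dynamics (h : IsJordanTransform G SL J)
    (A : Matrix (Fin n) (Fin n) ℝ) (B : Matrix (Fin n) (Fin m) ℝ) (F : Matrix (Fin m) (Fin n) ℝ)
    (c : ℝ) (x y : Fin (M + 1) → EuclideanSpace ℝ (Fin n)) :
    xhatTail SL (fun i => Matrix.toEuclideanLin A (x i) +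
        Matrix.toEuclideanLin B (input G c F y i)) =
      Matrix.toEuclideanLin (Ahat A B F c J) (xhatTail SL x) +
        Matrix.toEuclideanLin (Bhat B F c SL J) (stackC (y - x)) := by
  have hsum : (fun i => Matrix.toEuclideanLin A (x i) +
        Matrix.toEuclideanLin B (input G c F y i)) =
      (fun i => Matrix.toEuclideanLin A (x i)) +
        fun i => Matrix.toEuclideanLin (c • (B * F)) (disagreement G y i) := by
    funext i
    rw [toEuclideanLin_input]; rfl
  have hy : stackC y = stackC x + stackC (y - x) := by rw [← stackC_add]; simp
  rw [hsum, xhatTail_eq, xhatTail_eq, stackC_add, stackC_map, stackC_map, toC_smul,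
    EventConsensus.stackC_disagreement, map_add, ← toEuclideanLin_mul, ← toEuclideanLin_mul,
    ← toEuclideanLin_mul, ← toEuclideanLin_mul, Ahat, Bhat, hy, map_add]
  simp only [Matrix.add_mul, map_add, LinearMap.add_apply, ← Matrix.mul_kronecker_mul,
    Matrix.one_mul, Matrix.mul_one, h.invTail_mul_laplacian, Matrix.smul_mul,
    Matrix.mul_smul, ← Delta_eq, Matrix.smul_kronecker, Matrix.kronecker_smul]
  abel

/-- The first column of `SL` is constant, so the first mode enters all agents equally and cancels in
differences. Hence x̂ → 0 implies consensus. -/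
theorem IsJordanTransform.sub_eq_sum (h : IsJordanTransform G SL J) (hG : HasSpanningTree G)
    (v : Fin (M + 1) → EuclideanSpace ℝ (Fin n)) (i j : Fin (M + 1)) (a : Fin n) :
    ((v i a - v j a : ℝ) : ℂ) =
      ∑ k : Fin M, (SL i k.succ - SL j k.succ) * xhatTail SL v (k, a) := by
  have hz : ∀ k : Fin M, xhatTail SL v (k, a) = (SL⁻¹ *ᵥ fun l => ((v l a : ℝ) : ℂ)) k.succ := by
    intro k
    rw [xhatTail_eq]
    simp [invTail, stackC, Matrix.toLpLin_apply, Matrix.mulVec, dotProduct, Fintype.sum_prod_type,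
      Matrix.one_apply]
  have hS : ∀ i, ((v i a : ℝ) : ℂ) = SL i 0 * (SL⁻¹ *ᵥ fun l => ((v l a : ℝ) : ℂ)) 0 +
      ∑ k : Fin M, SL i k.succ * xhatTail SL v (k, a) := by
    intro i
    have h1 : SL *ᵥ (SL⁻¹ *ᵥ fun l => ((v l a : ℝ) : ℂ)) = fun l => ((v l a : ℝ) : ℂ) := by
      rw [Matrix.mulVec_mulVec, Matrix.mul_nonsing_inv _ h.1, Matrix.one_mulVec]
    have h2 := congrFun h1 i
    simp only [hz]
    rw [← h2]
    conv_lhs => rw [Matrix.mulVec, dotProduct, Fin.sum_univ_succ]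
  push_cast
  rw [hS i, hS j, h.col_zero_constant hG i j]
  simp only [sub_mul, Finset.sum_sub_distrib]
  ring

/-- Passing to the coordinates `x̂`, as a linear map. -/
noncomputable def xhatTailLinear (SL : Matrix (Fin (M + 1)) (Fin (M + 1)) ℂ) :
    (Fin (M + 1) → EuclideanSpace ℝ (Fin n)) →ₗ[ℝ] EuclideanSpace ℂ (Fin M × Fin n) where
  toFun := xhatTail SL
  map_add' v w := by simp only [xhatTail_eq, stackC_add, map_add]
  map_smul' a v := by
    simp only [xhatTail_eq, stackC_smul, map_smul, RingHom.id_apply]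
    ext; simp

end Transform

/-! ### Event structure of a trajectory and the scalar error profile. -/

section Trajectory

variable {N n m : ℕ} {G : Digraph (Fin N)} {A : Matrix (Fin n) (Fin n) ℝ}
  {B : Matrix (Fin n) (Fin m) ℝ} {F : Matrix (Fin m) (Fin n) ℝ} {c β lam : ℝ} {T : EReal}
  {x y : Fin N → ℝ → EuclideanSpace ℝ (Fin n)} {E : Fin N → Set ℝ}

namespace IsTrajectory

theorem lt_horizon_of_le {r t : ℝ} (hrt : r ≤ t) (ht : (t : EReal) < T) : (r : EReal) < T :=
  (EReal.coe_le_coe_iff.2 hrt).trans_lt ht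

theorem y_right_deriv (h : IsTrajectory G A B F c β lam T x y E) (i : Fin N) {t : ℝ} (h0 : 0 ≤ t)
    (hT : (t : EReal) < T) :
    HasDerivWithinAt (y i) (Matrix.toEuclideanLin A (y i t)) (Set.Ici t) t := by
  by_cases hE : t ∈ E i
  · exact h.y_deriv_event i t hE
  · have h0' : 0 < t := h0.lt_of_ne fun h0' => hE (h0' ▸ h.zero_mem i)
    exact (h.y_deriv i t h0' hT hE).hasDerivWithinAt

theorem error_right_deriv (h : IsTrajectory G A B F c β lam T x y E) (i : Fin N) {t : ℝ}
    (h0 : 0 ≤ t) (hT : (t : EReal) < T) :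
    HasDerivWithinAt (fun r => y i r - x i r)
      (Matrix.toEuclideanLin A (y i t - x i t) -
        Matrix.toEuclideanLin (c • (B * F)) (disagreement G (fun j => y j t) i))
      (Set.Ici t) t := by
  refine ((h.y_right_deriv i h0 hT).fun_sub (h.x_deriv i t h0 hT)).congr_deriv ?_
  rw [toEuclideanLin_input, map_sub]
  abel

theorem error_continuousOn (h : IsTrajectory G A B F c β lam T x y E) {i : Fin N} {s t : ℝ}
    (hs : s ∈ E i) (hT : (t : EReal) < T) (hno : ∀ r ∈ E i, r ∉ Set.Ioc s t) :
    ContinuousOn (fun r => y i r - x i r) (Set.Icc s t) := by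
  have hs0 := (h.events_mem i s hs).1
  refine ContinuousOn.sub (fun r hr => ?_) ((h.x_cont i).mono fun r hr =>
    ⟨hs0.trans hr.1, lt_horizon_of_le hr.2 hT⟩)
  rcases hr.1.eq_or_lt with rfl | hsr
  · exact (h.y_deriv_event i s hs).continuousWithinAt.mono Set.Icc_subset_Ici_self
  · exact (h.y_deriv i r (hs0.trans_lt hsr) (lt_horizon_of_le hr.2 hT)
      fun hE => hno r hE ⟨hsr, hr.2⟩).continuousAt.continuousWithinAt

/-- Between events, the error stays strictly below the threshold. -/
theorem norm_error_lt (h : IsTrajectory G A B F c β lam T x y E) (hβ : 0 < β) {i : Fin N}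
    {s t : ℝ} (hst : s ≤ t) (hs : s ∈ E i) (hT : (t : EReal) < T)
    (hno : ∀ r ∈ E i, r ∉ Set.Ioc s t) :
    ‖y i t - x i t‖ < β * Real.exp (-lam * t) := by
  by_contra! hge
  have hs0 := (h.events_mem i s hs).1
  have hcont := h.error_continuousOn hs hT hno
  have hf : ContinuousOn (fun r => ‖y i r - x i r‖ - β * Real.exp (-lam * r)) (Set.Icc s t) :=
    hcont.norm.sub (by fun_prop)
  have hfs : ‖y i s - x i s‖ - β * Real.exp (-lam * s) < 0 := by
    rw [h.y_reset i s hs, sub_self, norm_zero, zero_sub, neg_lt_zero]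
    positivity
  -- The error vanishes at `s`, so it would meet the threshold at some r in (s, t]; by continuity
  -- that forces an event at r.
  obtain ⟨r, hr, hr0⟩ := intermediate_value_Icc hst hf ⟨hfs.le, sub_nonneg.2 hge⟩
  have hsr : s < r := hr.1.lt_of_ne fun hsr => by
    subst hsr
    exact hfs.ne hr0
  have hrT := lt_horizon_of_le hr.2 hT
  have hrpos : 0 < r := hs0.trans_lt hsr
  refine hno r ((h.trigger i r hrpos hrT).2 ?_) ⟨hsr, hr.2⟩
  have h1 : Tendsto (fun r => ‖y i r - x i r‖) (𝓝[<] r) (𝓝 ‖y i r - x i r‖) :=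
    (hcont.norm r hr).mono_left (nhdsWithin_le_of_mem (mem_of_superset (Ioo_mem_nhdsLT hsr)
      fun z hz => ⟨hz.1.le, hz.2.le.trans hr.2⟩))
  rwa [sub_eq_zero.1 hr0] at h1

theorem exists_last_event (h : IsTrajectory G A B F c β lam T x y E) (i : Fin N) {t : ℝ}
    (h0 : 0 ≤ t) (hT : (t : EReal) < T) :
    ∃ s ∈ E i, s ≤ t ∧ ∀ r ∈ E i, r ∉ Set.Ioc s t := by
  obtain ⟨s, hs, hmax⟩ := Set.exists_max_image _ id (h.locally_finite i t hT)
    ⟨0, h.zero_mem i, h0⟩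
  exact ⟨s, hs.1, hs.2, fun r hr hr' => (hmax r ⟨hr, hr'.2⟩).not_gt hr'.1⟩

theorem norm_error_le (h : IsTrajectory G A B F c β lam T x y E) (hβ : 0 < β) (i : Fin N) {t : ℝ}
    (h0 : 0 ≤ t) (hT : (t : EReal) < T) : ‖y i t - x i t‖ ≤ β * Real.exp (-lam * t) := by
  obtain ⟨s, hs, hst, hno⟩ := h.exists_last_event i h0 hT
  exact (h.norm_error_lt hβ hst hs hT hno).le

theorem exists_next_event (h : IsTrajectory G A B F c β lam T x y E) {i : Fin N} {s s' : ℝ}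
    (hs' : s' ∈ E i) (hss' : s < s') :
    ∃ r ∈ E i, s < r ∧ r ≤ s' ∧ ∀ z ∈ E i, z ∉ Set.Ioo s r := by
  have hfin := h.locally_finite i s' (h.events_mem i s' hs').2
  obtain ⟨r, hr, hmin⟩ := Set.exists_min_image ((E i ∩ Set.Iic s') ∩ Set.Ioi s) id
    (hfin.subset Set.inter_subset_left) ⟨s', ⟨hs', Set.mem_Iic.2 le_rfl⟩, hss'⟩
  exact ⟨r, hr.1.1, hr.2, hr.1.2, fun z hz hz' =>
    (hmin z ⟨⟨hz, hz'.2.le.trans hr.1.2⟩, hz'.1⟩).not_gt hz'.2⟩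

/-- A positive lower bound for the inter-event times excludes a finite horizon. -/
theorem horizon_eq_top (h : IsTrajectory G A B F c β lam T x y E) {δ : ℝ} (hδ : 0 < δ)
    (hgap : ∀ i, ∀ s ∈ E i, ∀ s' ∈ E i, s < s' → δ ≤ s' - s) : T = ⊤ := by
  by_contra hT
  obtain ⟨i, hi⟩ := h.maximal hT
  lift T to ℝ using ⟨hT, (bot_lt_iff_ne_bot.1 (bot_le.trans_lt h.pos))⟩
  -- Each cell of length `δ` contains at most one event, and finitely many cells cover [0, T).
  refine hi (Set.Finite.of_injOn (f := fun s : ℝ => ⌊s / δ⌋) (t := Set.Icc 0 ⌊T / δ⌋) ?_ ?_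
    (Set.finite_Icc _ _))
  · intro s hs
    have h1 := h.events_mem i s hs
    have h2 : s < T := EReal.coe_lt_coe_iff.1 h1.2
    exact ⟨Int.floor_nonneg.2 (div_nonneg h1.1 hδ.le), Int.floor_le_floor (by gcongr)⟩
  · have key : ∀ s ∈ E i, ∀ s' ∈ E i, ⌊s / δ⌋ = ⌊s' / δ⌋ → ¬ s < s' := by
      intro s hs s' hs' heq hlt
      have h1 := Int.abs_sub_lt_one_of_floor_eq_floor heq
      have h2 := hgap i s hs s' hs' hlt
      rw [← sub_div, abs_div, abs_of_pos hδ, div_lt_one hδ, abs_sub_comm, abs_of_pos (by linarith)]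
        at h1
      linarith
    intro s hs s' hs' heq
    exact le_antisymm (not_lt.1 (key s' hs' s hs heq.symm)) (not_lt.1 (key s hs s' hs' heq))

theorem not_isZeno (h : IsTrajectory G A B F c β lam T x y E) (hT : T = ⊤) : ¬ IsZeno E := by
  rintro ⟨i, s, hs⟩
  refine hs ((h.locally_finite i s ?_).subset (Set.inter_subset_inter_right _
    Set.Icc_subset_Iic_self))
  rw [hT]
  exact EReal.coe_lt_top s

end IsTrajectory

/-- The solution of `φ' = a φ + k (k₁ exp(-lh t) + k₂ exp(-lam t))` vanishing at time `s`. -/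
noncomputable def errorProfile (k k₁ k₂ a lh lam s t : ℝ) : ℝ :=
  k * (k₁ * (Real.exp (a * (t - s)) * Real.exp (-lh * s) - Real.exp (-lh * t)) / (a + lh) +
    k₂ * (Real.exp (a * (t - s)) * Real.exp (-lam * s) - Real.exp (-lam * t)) / (a + lam))

theorem errorProfile_self (k k₁ k₂ a lh lam s : ℝ) : errorProfile k k₁ k₂ a lh lam s s = 0 := by
  simp [errorProfile]

theorem hasDerivAt_errorProfile {k k₁ k₂ a lh lam : ℝ} (hlh : a + lh ≠ 0) (hlam : a + lam ≠ 0)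
    (s t : ℝ) :
    HasDerivAt (errorProfile k k₁ k₂ a lh lam s)
      (a * errorProfile k k₁ k₂ a lh lam s t +
        k * (k₁ * Real.exp (-lh * t) + k₂ * Real.exp (-lam * t))) t := by
  have h1 : HasDerivAt (fun t => Real.exp (a * (t - s))) (Real.exp (a * (t - s)) * a) t := by
    simpa using (((hasDerivAt_id t).sub_const s).const_mul a).exp
  have h2 : ∀ b : ℝ, HasDerivAt (fun t => Real.exp (-b * t)) (Real.exp (-b * t) * -b) t := by
    intro b
    simpa using ((hasDerivAt_id t).const_mul (-b)).exp
  have h3 : ∀ q b : ℝ, HasDerivAt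
      (fun t => q * (Real.exp (a * (t - s)) * Real.exp (-b * s) - Real.exp (-b * t)) / (a + b))
      (q * (Real.exp (a * (t - s)) * a * Real.exp (-b * s) - Real.exp (-b * t) * -b) / (a + b))
      t := fun q b =>
    (((h1.mul_const _).fun_sub (h2 b)).const_mul q).div_const _
  refine (((h3 k₁ lh).fun_add (h3 k₂ lam)).const_mul k).congr_deriv ?_
  unfold errorProfile
  field_simp
  ring

/-- The profile needs at least the time `log (1 + β / K₃) / (a + lh)` to reach the threshold. -/
theorem log_div_le_of_threshold_le_errorProfile {k k₁ k₂ a lh lam β s t : ℝ} (ha : 0 ≤ a)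
    (hlam : 0 < lam) (hlt : lam < lh) (hs : 0 ≤ s) (hst : s ≤ t) (hk : 0 ≤ k) (hk₂ : 0 ≤ k₂)
    (hk₁ : -k₂ ≤ k₁)
    (hK : 0 < k * (k₁ * Real.exp ((lam - lh) * s) / (a + lh) + k₂ / (a + lam))) (hβ : 0 ≤ β)
    (h : β * Real.exp (-lam * t) ≤ errorProfile k k₁ k₂ a lh lam s t) :
    Real.log (1 + β / (k * (k₁ * Real.exp ((lam - lh) * s) / (a + lh) + k₂ / (a + lam)))) /
      (a + lh) ≤ t - s := by
  have hu : 0 < a + lh := by linarith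
  have hv : 0 < a + lam := by linarith
  -- After multiplication by exp(lam t), every exponential in the profile is a product of `w`, `g`
  -- and `p`; the goal becomes 1 + β / K ≤ p.
  set w := Real.exp ((lam - lh) * s) with hw
  set g := Real.exp ((lam - lh) * (t - s)) with hg
  set p := Real.exp ((a + lh) * (t - s)) with hp
  have hw1 : w ≤ 1 := Real.exp_le_one_iff.2 (by nlinarith)
  have hg1 : g ≤ 1 := Real.exp_le_one_iff.2 (by nlinarith)
  have hp1 : 1 ≤ p := Real.one_le_exp (by nlinarith)
  have hw0 : 0 < w := Real.exp_pos _
  set L := Real.exp (lam * t) with hL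
  have e1 : Real.exp (-lam * t) * L = 1 := by
    rw [hL, ← Real.exp_add]; simp
  have e2 : Real.exp (a * (t - s)) * Real.exp (-lh * s) * L = w * (p * g) := by
    rw [hL, hw, hp, hg, ← Real.exp_add, ← Real.exp_add, ← Real.exp_add, ← Real.exp_add]
    ring_nf
  have e3 : Real.exp (-lh * t) * L = w * g := by
    rw [hL, hw, hg, ← Real.exp_add, ← Real.exp_add]
    ring_nf
  have e4 : Real.exp (a * (t - s)) * Real.exp (-lam * s) * L = p * g := by
    rw [hL, hp, hg, ← Real.exp_add, ← Real.exp_add, ← Real.exp_add]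
    ring_nf
  have h1 : β ≤ k * (k₁ * (w * (p * g) - w * g) / (a + lh) + k₂ * (p * g - 1) / (a + lam)) := by
    have h2 := mul_le_mul_of_nonneg_right h (Real.exp_pos (lam * t)).le
    rw [← hL, mul_assoc, e1, mul_one, errorProfile] at h2
    refine h2.trans (le_of_eq ?_)
    rw [← e1, ← e2, ← e3, ← e4]
    ring
  set X := (1 - g) * (p - 1) with hX
  have hX0 : 0 ≤ X := mul_nonneg (by linarith) (by linarith)
  have hk₁w : -k₂ ≤ k₁ * w := by nlinarith
  have h2 : -(k₂ * X / (a + lam)) ≤ k₁ * w * X / (a + lh) := by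
    have h3 : k₂ * X / (a + lh) ≤ k₂ * X / (a + lam) := by gcongr
    have h4 : -(k₂ * X) / (a + lh) ≤ k₁ * w * X / (a + lh) := by gcongr; nlinarith
    rw [neg_div] at h4
    linarith
  have h3 : k₂ * X / (a + lam) ≤ k₂ * (p - p * g) / (a + lam) := by
    gcongr
    nlinarith
  -- The slack is k₁wX/(a + lh) + k₂(p - pg)/(a + lam). It is nonnegative even for k₁ < 0, since k₁w
  -- ≥ -k₂, X ≤ p - pg and a + lam < a + lh.
  have h4 : k₁ * (w * (p * g) - w * g) / (a + lh) + k₂ * (p * g - 1) / (a + lam) ≤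
      (k₁ * w / (a + lh) + k₂ / (a + lam)) * (p - 1) := by
    have e : (k₁ * w / (a + lh) + k₂ / (a + lam)) * (p - 1) =
        k₁ * (w * (p * g) - w * g) / (a + lh) + k₂ * (p * g - 1) / (a + lam) +
          (k₁ * w * X / (a + lh) + k₂ * (p - p * g) / (a + lam)) := by
      rw [hX]; ring
    linarith
  set K := k * (k₁ * w / (a + lh) + k₂ / (a + lam)) with hKdef
  have h5 : β ≤ K * (p - 1) := by
    rw [hKdef, mul_assoc]
    exact h1.trans (mul_le_mul_of_nonneg_left h4 hk)
  have h6 : 1 + β / K ≤ p := by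
    have : β / K ≤ p - 1 := (div_le_iff₀ hK).2 (by linarith)
    linarith
  rw [div_le_iff₀ hu, mul_comm]
  exact (Real.log_le_iff_le_exp (by positivity)).2 h6

end Trajectory

/-! ### Decay of x̂, error bounds and consensus. -/

section Estimates

variable {M n m : ℕ} {G : Digraph (Fin (M + 1))} {A : Matrix (Fin n) (Fin n) ℝ}
  {B : Matrix (Fin n) (Fin m) ℝ} {F : Matrix (Fin m) (Fin n) ℝ} {c β lam bh lh : ℝ} {T : EReal}
  {SL : Matrix (Fin (M + 1)) (Fin (M + 1)) ℂ} {J : Matrix (Fin M) (Fin M) ℂ}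
  {x y : Fin (M + 1) → ℝ → EuclideanSpace ℝ (Fin n)} {E : Fin (M + 1) → Set ℝ}

namespace IsTrajectory

theorem xhatTail_continuousOn (h : IsTrajectory G A B F c β lam T x y E) {t : ℝ}
    (hT : (t : EReal) < T) :
    ContinuousOn (fun r => xhatTail SL fun j => x j r) (Set.Icc 0 t) := by
  have h1 : ContinuousOn (fun r j => x j r) (Set.Icc 0 t) := continuousOn_pi.2 fun j =>
    (h.x_cont j).mono fun r hr => ⟨hr.1, lt_horizon_of_le hr.2 hT⟩
  have h2 : Continuous (xhatTailLinear (n := n) SL) := LinearMap.continuous_of_finiteDimensional _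
  have h3 : ∀ r, (xhatTail SL fun j => x j r) = xhatTailLinear SL fun j => x j r := fun _ => rfl
  simp only [h3]
  exact h2.comp_continuousOn h1

theorem xhatTail_right_deriv (h : IsTrajectory G A B F c β lam T x y E)
    (hS : IsJordanTransform G SL J) {t : ℝ} (h0 : 0 ≤ t) (hT : (t : EReal) < T) :
    HasDerivWithinAt (fun r => xhatTail SL fun j => x j r)
      (Matrix.toEuclideanLin (Ahat A B F c J) (xhatTail SL fun j => x j t) +
        Matrix.toEuclideanLin (Bhat B F c SL J) (stackC fun j => y j t - x j t))
      (Set.Ici t) t := by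
  have h1 := hasDerivWithinAt_pi.2 fun j => h.x_deriv j t h0 hT
  have h2 := (LinearMap.toContinuousLinearMap
    (xhatTailLinear (n := n) SL)).hasFDerivAt.comp_hasDerivWithinAt t h1
  have h3 := hS.xhatTail_dynamics A B F c (fun j => x j t) fun j => y j t
  have h4 : (fun j => y j t - x j t) = (fun j => y j t) - fun j => x j t := rfl
  rw [h4, ← h3]
  exact h2

theorem norm_stack_error_le (h : IsTrajectory G A B F c β lam T x y E) (hβ : 0 < β) {t : ℝ}
    (h0 : 0 ≤ t) (hT : (t : EReal) < T) :
    ‖stackR fun j => y j t - x j t‖ ≤ √((M + 1 : ℕ) : ℝ) * (β * Real.exp (-lam * t)) :=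
  norm_stackR_le (by positivity) fun i => h.norm_error_le hβ i h0 hT

theorem norm_xhatTail_le (h : IsTrajectory G A B F c β lam T x y E) (hβ : 0 < β)
    (hS : IsJordanTransform G SL J) (hbh : 0 ≤ bh) (hlt : lam < lh)
    (hexp : ExpBound (Ahat A B F c J) bh lh) {t : ℝ} (h0 : 0 ≤ t) (hT : (t : EReal) < T) :
    ‖xhatTail SL fun j => x j t‖ ≤
      bh * ‖xhatTail SL fun j => x j 0‖ * Real.exp (-lh * t) +
        bh * (‖Bhat B F c SL J‖ * √((M + 1 : ℕ) : ℝ) * β) / (lh - lam) *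
          (Real.exp (-lam * t) - Real.exp (-lh * t)) := by
  refine norm_le_of_exp_decay (z := fun t => xhatTail SL fun j => x j t)
    (h := fun t => Matrix.toEuclideanLin (Bhat B F c SL J) (stackC fun j => y j t - x j t))
    (K := ‖Bhat B F c SL J‖ * √((M + 1 : ℕ) : ℝ) * β) (lam := lam)
    hbh hexp h0 hlt (h.xhatTail_continuousOn hT)
    (fun r hr => h.xhatTail_right_deriv hS hr.1 (lt_horizon_of_le hr.2.le hT)) fun r hr => ?_
  refine (norm_toEuclideanLin_le _ _).trans ?_
  rw [norm_stackC, mul_assoc, mul_assoc]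
  exact mul_le_mul_of_nonneg_left
    (h.norm_stack_error_le hβ hr.1 (lt_horizon_of_le hr.2.le hT)) (norm_nonneg _)

/-- Writing y = x + e, the part from x is Θ applied to x̂ and the part from e is bounded by the
threshold. Collecting terms by decay rate produces K₁ and K₂; the negative term of K₁ comes from the
zero initial value of the forced response. -/
theorem norm_disagreement_le (h : IsTrajectory G A B F c β lam T x y E) (hβ : 0 < β)
    (hS : IsJordanTransform G SL J) (hbh : 0 ≤ bh) (hlt : lam < lh)
    (hexp : ExpBound (Ahat A B F c J) bh lh) (i : Fin (M + 1)) {t : ℝ} (h0 : 0 ≤ t)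
    (hT : (t : EReal) < T) :
    ‖disagreement G (fun j => y j t) i‖ ≤
      K1 B F c SL J bh lh β lam (fun j => x j 0) * Real.exp (-lh * t) +
        K2 G B F c SL J bh lh β lam * Real.exp (-lam * t) := by
  have hy : (fun j => y j t) = (fun j => x j t) + fun j => y j t - x j t := by
    funext j; simp
  have h1 : ‖disagreement G (fun j => x j t) i‖ ≤ ‖Theta SL J‖ * ‖xhatTail SL fun j => x j t‖ :=
    calc _ ≤ ‖stackR (disagreement G fun j => x j t)‖ := norm_le_norm_stackR _ i
      _ = ‖stackC (disagreement G fun j => x j t)‖ := (norm_stackC _).symm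
      _ ≤ _ := by
        rw [hS.stackC_disagreement]
        exact norm_toEuclideanLin_kronecker_one_le _ _
  have h2 : ‖disagreement G (fun j => y j t - x j t) i‖ ≤
      ‖laplacian G‖ * (√((M + 1 : ℕ) : ℝ) * (β * Real.exp (-lam * t))) :=
    calc _ ≤ ‖stackR (disagreement G fun j => y j t - x j t)‖ := norm_le_norm_stackR _ i
      _ ≤ ‖laplacian G‖ * ‖stackR fun j => y j t - x j t‖ := by
        rw [stackR_disagreement]
        exact norm_toEuclideanLin_kronecker_one_le _ _
      _ ≤ _ := mul_le_mul_of_nonneg_left (h.norm_stack_error_le hβ h0 hT) (norm_nonneg _)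
  have h3 := mul_le_mul_of_nonneg_left (h.norm_xhatTail_le hβ hS hbh hlt hexp h0 hT)
    (norm_nonneg (Theta SL J))
  rw [hy, disagreement_add]
  refine (norm_add_le _ _).trans ((add_le_add (h1.trans h3) h2).trans (le_of_eq ?_))
  unfold K1 K2
  ring

theorem norm_error_le_errorProfile (h : IsTrajectory G A B F c β lam T x y E) (hβ : 0 < β)
    (hS : IsJordanTransform G SL J) (hbh : 0 ≤ bh) (hlam : 0 < lam) (hlt : lam < lh)
    (hexp : ExpBound (Ahat A B F c J) bh lh) {i : Fin (M + 1)} {s t : ℝ} (hst : s ≤ t)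
    (hs : s ∈ E i) (hT : (t : EReal) < T) (hno : ∀ r ∈ E i, r ∉ Set.Ioc s t) :
    ‖y i t - x i t‖ ≤ errorProfile ‖c • (B * F)‖ (K1 B F c SL J bh lh β lam (fun j => x j 0))
      (K2 G B F c SL J bh lh β lam) ‖A‖ lh lam s t := by
  have hs0 := (h.events_mem i s hs).1
  have hA := norm_nonneg A
  refine norm_le_of_deriv_le_linear (f := fun r => y i r - x i r) hst
    (h.error_continuousOn hs hT hno)
    (fun r hr => h.error_right_deriv i (hs0.trans hr.1) (lt_horizon_of_le hr.2.le hT))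
    (fun r hr => ?_)
    (hasDerivAt_errorProfile (by linarith : (0 : ℝ) < ‖A‖ + lh).ne'
      (by linarith : (0 : ℝ) < ‖A‖ + lam).ne' s) ?_
  · refine (norm_sub_le _ _).trans (add_le_add (norm_toEuclideanLin_le _ _)
      ((norm_toEuclideanLin_le _ _).trans (mul_le_mul_of_nonneg_left ?_ (norm_nonneg _))))
    exact h.norm_disagreement_le hβ hS hbh hlt hexp i (hs0.trans hr.1)
      (lt_horizon_of_le hr.2.le hT)
  · rw [errorProfile_self, h.y_reset i s hs, sub_self, norm_zero]

/-- At `s'` the model is already reset and the error is 0, so the profile bound is used on (s, s')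
and passed to the left limit. -/
theorem threshold_le_errorProfile (h : IsTrajectory G A B F c β lam T x y E) (hβ : 0 < β)
    (hS : IsJordanTransform G SL J) (hbh : 0 ≤ bh) (hlam : 0 < lam) (hlt : lam < lh)
    (hexp : ExpBound (Ahat A B F c J) bh lh) {i : Fin (M + 1)} {s s' : ℝ} (hss' : s < s')
    (hs : s ∈ E i) (hs' : s' ∈ E i) (hno : ∀ r ∈ E i, r ∉ Set.Ioo s s') :
    β * Real.exp (-lam * s') ≤
      errorProfile ‖c • (B * F)‖ (K1 B F c SL J bh lh β lam (fun j => x j 0))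
        (K2 G B F c SL J bh lh β lam) ‖A‖ lh lam s s' := by
  have hs0 := (h.events_mem i s hs).1
  have hT := (h.events_mem i s' hs').2
  have hA := norm_nonneg A
  have h1 := (h.trigger i s' (hs0.trans_lt hss') hT).1 hs'
  have h2 := (hasDerivAt_errorProfile (k := ‖c • (B * F)‖)
    (k₁ := K1 B F c SL J bh lh β lam (fun j => x j 0))
    (k₂ := K2 G B F c SL J bh lh β lam)
    (by linarith : (0 : ℝ) < ‖A‖ + lh).ne' (by linarith : (0 : ℝ) < ‖A‖ + lam).ne'
      s s').continuousAt
  refine le_of_tendsto_of_tendsto h1 (h2.tendsto.mono_left nhdsWithin_le_nhds) ?_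
  filter_upwards [Ioo_mem_nhdsLT hss'] with r hr
  exact h.norm_error_le_errorProfile hβ hS hbh hlam hlt hexp hr.1.le hs
    (lt_horizon_of_le hr.2.le hT) fun z hz hz' => hno z hz ⟨hz'.1, hz'.2.trans_lt hr.2⟩

theorem tendsto_xhatTail (h : IsTrajectory G A B F c β lam ⊤ x y E) (hβ : 0 < β)
    (hS : IsJordanTransform G SL J) (hbh : 0 ≤ bh) (hlam : 0 < lam) (hlt : lam < lh)
    (hexp : ExpBound (Ahat A B F c J) bh lh) :
    Tendsto (fun t => xhatTail SL fun j => x j t) atTop (𝓝 0) := by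
  have hdecay : ∀ b : ℝ, 0 < b → Tendsto (fun t : ℝ => Real.exp (-b * t)) atTop (𝓝 0) := by
    intro b hb
    exact Real.tendsto_exp_atBot.comp (tendsto_id.const_mul_atTop_of_neg (neg_neg_of_pos hb))
  have h1 := hdecay lh (hlam.trans hlt)
  have h2 := hdecay lam hlam
  refine squeeze_zero_norm' (eventually_atTop.2 ⟨0, fun t ht =>
    h.norm_xhatTail_le hβ hS hbh hlt hexp ht (EReal.coe_lt_top t)⟩) ?_
  simpa using (h1.const_mul (bh * ‖xhatTail SL fun j => x j 0‖)).add ((h2.sub h1).const_mul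
    (bh * (‖Bhat B F c SL J‖ * √((M + 1 : ℕ) : ℝ) * β) / (lh - lam)))

theorem consensus (h : IsTrajectory G A B F c β lam ⊤ x y E) (hβ : 0 < β)
    (hG : HasSpanningTree G)
    (hS : IsJordanTransform G SL J) (hbh : 0 ≤ bh) (hlam : 0 < lam) (hlt : lam < lh)
    (hexp : ExpBound (Ahat A B F c J) bh lh) : Consensus x := by
  intro i j
  have hz := h.tendsto_xhatTail hβ hS hbh hlam hlt hexp
  have hcoord : ∀ a, Tendsto (fun t => x i t a - x j t a) atTop (𝓝 0) := by
    intro a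
    have h1 : Tendsto (fun t => ∑ k : Fin M, (SL i k.succ - SL j k.succ) *
        (xhatTail SL fun j => x j t) (k, a)) atTop
        (𝓝 (∑ k : Fin M, (SL i k.succ - SL j k.succ) *
          (0 : EuclideanSpace ℂ (Fin M × Fin n)) (k, a))) :=
      tendsto_finsetSum _ fun k _ => (((EuclideanSpace.proj (k, a) :
        EuclideanSpace ℂ (Fin M × Fin n) →L[ℂ] ℂ).continuous.tendsto _).comp hz).const_mul _
    simp only [← hS.sub_eq_sum hG] at h1
    have h2 := (Complex.continuous_re.tendsto _).comp h1
    simpa [Function.comp_def] using h2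
  have hvec : Tendsto (fun t => x i t - x j t) atTop (𝓝 0) :=
    ((PiLp.continuous_toLp 2 fun _ : Fin n => ℝ).tendsto 0).comp (tendsto_pi_nhds.2 hcoord)
  simpa using hvec.norm

end IsTrajectory

end Estimates

/-! ### Positivity and uniform bounds for K₃. -/

section InterEventTime

variable {M n m : ℕ} {G : Digraph (Fin (M + 1))} {A : Matrix (Fin n) (Fin n) ℝ}
  {B : Matrix (Fin n) (Fin m) ℝ} {F : Matrix (Fin m) (Fin n) ℝ} {c β lam bh lh : ℝ}
  {SL : Matrix (Fin (M + 1)) (Fin (M + 1)) ℂ} {J : Matrix (Fin M) (Fin M) ℂ}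
  {x0 : Fin (M + 1) → EuclideanSpace ℝ (Fin n)}

theorem K2_pos (hG : laplacian G ≠ 0) (hbh : 0 ≤ bh) (hlt : lam < lh) (hβ : 0 < β) :
    0 < K2 G B F c SL J bh lh β lam := by
  have h1 : 0 < lh - lam := sub_pos.2 hlt
  have h2 : 0 < ‖laplacian G‖ := norm_pos_iff.2 hG
  have h3 : 0 < √((M + 1 : ℕ) : ℝ) := Real.sqrt_pos.2 (by positivity)
  unfold K2
  positivity

/-- The B̂ terms cancel in K₁ + K₂. This replaces a sign condition on K₁, which may be negative. -/
theorem neg_K2_lt_K1 (hG : laplacian G ≠ 0) (hbh : 0 ≤ bh) (hβ : 0 < β) :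
    -K2 G B F c SL J bh lh β lam < K1 B F c SL J bh lh β lam x0 := by
  have h2 : 0 < ‖laplacian G‖ := norm_pos_iff.2 hG
  have h3 : 0 < √((M + 1 : ℕ) : ℝ) := Real.sqrt_pos.2 (by positivity)
  have h4 : 0 ≤ ‖Theta SL J‖ * (bh * ‖xhatTail SL x0‖) := by positivity
  have h5 : 0 < ‖laplacian G‖ * √((M + 1 : ℕ) : ℝ) * β := by positivity
  unfold K1 K2
  linarith

/-- A negative K₁ is outweighed: its term is at least -K₂/(‖A‖ + λ̂), and K₂/(‖A‖ + λ) is strictly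
larger than K₂/(‖A‖ + λ̂). -/
theorem K3_pos (hG : laplacian G ≠ 0) (hBF : c • (B * F) ≠ 0) (hbh : 0 ≤ bh) (hlam : 0 < lam)
    (hlt : lam < lh) (hβ : 0 < β) {s : ℝ} (hs : 0 ≤ s) :
    0 < K3 G A B F c SL J bh lh β lam x0 s := by
  have h1 := K2_pos (B := B) (F := F) (c := c) (SL := SL) (J := J) hG hbh hlt hβ
  have h2 := neg_K2_lt_K1 (B := B) (F := F) (c := c) (SL := SL) (J := J) (x0 := x0) (lam := lam)
    (lh := lh) hG hbh hβ
  have hA := norm_nonneg A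
  have hw : Real.exp ((lam - lh) * s) ≤ 1 := Real.exp_le_one_iff.2 (by nlinarith)
  have hw0 := Real.exp_pos ((lam - lh) * s)
  unfold K3
  refine mul_pos (norm_pos_iff.2 hBF) ?_
  set k₁ := K1 B F c SL J bh lh β lam x0
  set k₂ := K2 G B F c SL J bh lh β lam
  have h3 : -k₂ ≤ k₁ * Real.exp ((lam - lh) * s) := by nlinarith
  have h4 : -k₂ / (‖A‖ + lh) ≤ k₁ * Real.exp ((lam - lh) * s) / (‖A‖ + lh) := by
    gcongr
    linarith
  have h5 : k₂ / (‖A‖ + lh) < k₂ / (‖A‖ + lam) := by gcongr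
  rw [neg_div] at h4
  linarith

theorem K3_le (hlam : 0 < lam) (hlt : lam < lh) {s : ℝ} (hs : 0 ≤ s) :
    K3 G A B F c SL J bh lh β lam x0 s ≤
      ‖c • (B * F)‖ * (|K1 B F c SL J bh lh β lam x0| / (‖A‖ + lh) +
        K2 G B F c SL J bh lh β lam / (‖A‖ + lam)) := by
  have hA := norm_nonneg A
  have hw : Real.exp ((lam - lh) * s) ≤ 1 := Real.exp_le_one_iff.2 (by nlinarith)
  have hw0 := Real.exp_pos ((lam - lh) * s)
  unfold K3
  gcongr
  · linarith
  · calc _ ≤ |K1 B F c SL J bh lh β lam x0| * Real.exp ((lam - lh) * s) := by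
          gcongr; exact le_abs_self _
      _ ≤ |K1 B F c SL J bh lh β lam x0| * 1 := by gcongr
      _ = _ := mul_one _

/-- If BBᵀP = 0 with P invertible, then BBᵀ = 0 and B = 0, so the controllability matrix has rank 0
< n. -/
theorem gain_ne_zero (hn : 0 < n) (hAB : Controllable A B) {α : ℝ}
    {P : Matrix (Fin n) (Fin n) ℝ} (hP : SolvesLMI A B α P) : B * gain B P ≠ 0 := by
  rw [mul_gain]
  intro h0
  rw [neg_eq_zero] at h0
  have hdet : IsUnit P.det := (Matrix.isUnit_iff_isUnit_det P).1 hP.1.isUnit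
  have h1 : B * Bᵀ = 0 := by
    have := congrArg (· * P⁻¹) h0
    simpa [Matrix.mul_assoc, Matrix.mul_nonsing_inv P hdet] using this
  have hB : B = 0 := by
    have := Matrix.self_mul_conjTranspose_eq_zero (A := B)
    rw [Matrix.conjTranspose_eq_transpose_of_trivial] at this
    exact this.1 h1
  have hC : controllabilityMatrix A B = 0 := by
    ext i p
    simp [controllabilityMatrix, hB]
  rw [Controllable, hC, Matrix.rank_zero] at hAB
  omega

end InterEventTime

end EventConsensus

/-! ### The main theorem. -/

theorem theorem1 {M n m : ℕ} (hM : 0 < M) (hn : 0 < n)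
    (G : Digraph (Fin (M + 1))) (hG : EventConsensus.HasSpanningTree G)
    (A : Matrix (Fin n) (Fin n) ℝ) (B : Matrix (Fin n) (Fin m) ℝ)
    (hAB : EventConsensus.Controllable A B)
    (α : ℝ) (hα : 0 < α) (P : Matrix (Fin n) (Fin n) ℝ)
    (hP : EventConsensus.SolvesLMI A B α P)
    (F : Matrix (Fin m) (Fin n) ℝ) (hF : F = EventConsensus.gain B P)
    (lam2 : ℂ) (hlam2 : EventConsensus.IsLambdaTwo G lam2)
    (c : ℝ) (hc : 1 / lam2.re ≤ c)
    (SL : Matrix (Fin (M + 1)) (Fin (M + 1)) ℂ) (J : Matrix (Fin M) (Fin M) ℂ)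
    (hSL : EventConsensus.IsJordanTransform G SL J) :
    -- the matrix `Â` is Hurwitz: admissible parameters `β̂`, `λ̂` exist
    (∃ bh lh : ℝ, 0 < bh ∧ 0 < lh ∧
      EventConsensus.ExpBound (EventConsensus.Ahat A B F c J) bh lh) ∧
    -- and for all admissible parameters
    ∀ bh lh lam β : ℝ, 0 < bh → 0 < lam → lam < lh → 0 < β →
      EventConsensus.ExpBound (EventConsensus.Ahat A B F c J) bh lh →
      ∀ (T : EReal) (x y : Fin (M + 1) → ℝ → EuclideanSpace ℝ (Fin n))
        (E : Fin (M + 1) → Set ℝ),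
        EventConsensus.IsTrajectory G A B F c β lam T x y E →
        -- no Zeno behavior, so the trajectory is defined for all time
        ¬ EventConsensus.IsZeno E ∧ T = ⊤ ∧
        EventConsensus.Consensus x ∧
        -- the inter-event times are bounded below by the positive time `τ`
        (∀ i, ∀ s ∈ E i,
          0 < EventConsensus.K3 G A B F c SL J bh lh β lam (fun j => x j 0) s ∧
          0 < EventConsensus.tau G A B F c SL J bh lh β lam (fun j => x j 0) s ∧
          ∀ s' ∈ E i, s < s' →
            EventConsensus.tau G A B F c SL J bh lh β lam (fun j => x j 0) s ≤ s' - s) ∧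
        -- and `τ` is bounded away from zero over all agents and event times
        ∃ τ₀ : ℝ, 0 < τ₀ ∧ ∀ i, ∀ s ∈ E i,
          τ₀ ≤ EventConsensus.tau G A B F c SL J bh lh β lam (fun j => x j 0) s := by
  open EventConsensus in
  subst hF
  have h2 := hlam2.re_pos
  have hc0 : 0 < c := (by positivity : 0 < 1 / lam2.re).trans_le hc
  have hJc : ∀ k, 1 ≤ c * (J k k).re := by
    intro k
    have h3 := hSL.re_lambdaTwo_le_re_diag hG hlam2 k
    have h4 : 1 ≤ c * lam2.re := (div_le_iff₀ h2).1 hc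
    nlinarith
  have hBF : c • (B * gain B P) ≠ 0 := smul_ne_zero hc0.ne' (gain_ne_zero hn hAB hP)
  have hL := hlam2.laplacian_ne_zero
  refine ⟨exists_expBound_Ahat hα hP hSL.2.1 hJc, ?_⟩
  intro bh lh lam β hbh hlam hlt hβ hexp T x y E h
  have hA := norm_nonneg A
  have hlh : 0 < ‖A‖ + lh := by linarith
  set F := gain B P
  have hK3 : ∀ s : ℝ, 0 ≤ s → 0 < K3 G A B F c SL J bh lh β lam (fun j => x j 0) s :=
    fun s hs => K3_pos hL hBF hbh.le hlam hlt hβ hs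
  have htau : ∀ i, ∀ s ∈ E i, ∀ s' ∈ E i, s < s' →
      tau G A B F c SL J bh lh β lam (fun j => x j 0) s ≤ s' - s := by
    intro i s hs s' hs' hss'
    obtain ⟨r, hr, hsr, hrs', hno⟩ := h.exists_next_event hs' hss'
    have hs0 := (h.events_mem i s hs).1
    have := log_div_le_of_threshold_le_errorProfile hA hlam hlt hs0 hsr.le (norm_nonneg _)
      (K2_pos hL hbh.le hlt hβ).le (neg_K2_lt_K1 hL hbh.le hβ).le (hK3 s hs0) hβ.le
      (h.threshold_le_errorProfile hβ hSL hbh.le hlam hlt hexp hsr hs hr hno)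
    exact this.trans (by linarith)
  obtain ⟨τ₀, hτ₀, hle⟩ : ∃ τ₀ : ℝ, 0 < τ₀ ∧ ∀ s : ℝ, 0 ≤ s →
      τ₀ ≤ tau G A B F c SL J bh lh β lam (fun j => x j 0) s := by
    have hKle := fun s (hs : (0 : ℝ) ≤ s) =>
      K3_le (G := G) (A := A) (B := B) (F := F) (c := c) (SL := SL) (J := J) (bh := bh) (β := β)
        (x0 := fun j => x j 0) hlam hlt hs
    set K := ‖c • (B * F)‖ * (|K1 B F c SL J bh lh β lam (fun j => x j 0)| / (‖A‖ + lh) +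
        K2 G B F c SL J bh lh β lam / (‖A‖ + lam))
    have hK : 0 < K := (hK3 0 le_rfl).trans_le (hKle 0 le_rfl)
    -- τ decreases in K₃, so the bound `K`, which is independent of agent and event, gives a uniform
    -- lower bound.
    refine ⟨Real.log (1 + β / K) / (‖A‖ + lh), ?_, fun s hs => ?_⟩
    · have : 0 < β / K := by positivity
      exact div_pos (Real.log_pos (by linarith)) hlh
    · have := hK3 s hs
      unfold tau
      gcongr
      exact hKle s hs
  have hT : T = ⊤ := h.horizon_eq_top hτ₀ fun i s hs s' hs' hss' =>
    (hle s (h.events_mem i s hs).1).trans (htau i s hs s' hs' hss')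
  refine ⟨h.not_isZeno hT, hT, ?_, fun i s hs => ?_, τ₀, hτ₀, fun i s hs =>
    hle s (h.events_mem i s hs).1⟩
  · subst hT
    exact h.consensus hβ hG hSL hbh.le hlam hlt hexp
  · have hs0 := (h.events_mem i s hs).1
    exact ⟨hK3 s hs0, hτ₀.trans_le (hle s hs0), htau i s hs⟩
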